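/- Let $\mathbb R^{4,1}$ be Lorentz space with inner product $(\cdot,\cdot)$ of signature $(4,1)$, let $\mathcal L^4=\{x\ne0 : (x,x)=0\}$ be its light cone and $S^{3,1}=\{x : (x,x)=1\}$; points of $\mathbb P(\mathcal L^4)$ are the points of the conformal $3$-sphere and points of $S^{3,1}$ are its (oriented) $2$-spheres. Let $\Sigma^2$ be a smooth surface and $s:\Sigma^2\to S^{3,1}$ a smooth spacelike immersion (a sphere congruence; an immersion with two distinct envelopes is automatically spacelike). Let $s^{(1)}=\langle s\rangle\oplus ds(T\Sigma^2)$ be its first derived bundle, and let $R^1$ and $R^\perp$ be the curvatures of the connections that the flat connection $d$ of the trivial $\mathbb R^{4,1}$-bundle induces, by orthogonal projection, on $s^{(1)}$ and on the normal bundle $(s^{(1)})^\perp$. The congruence $s$ is a Ribaucour sphere congruence if $R^\perp=0$. An envelope of $s$ is a map $\langle f\rangle:\Sigma^2\to\mathbb P(\mathcal L^4)$ with a smooth lift $f$ such that $(f,s)=0$ and $(df,s)=0$. Two pointwise distinct maps $\langle f\rangle,\langle h\rangle:\Sigma^2\to\mathbb P(\mathcal L^4)$ are called Darboux transforms of each other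 if they are envelopes of a common Ribaucour sphere congruence, induce conformally equivalent metrics (that is, $(df,df)$ and $(dh,dh)$ are positive multiples of each other at every point where both maps are immersed), and are not trivially related, i.e., on no nonempty open subset of $\Sigma^2$ is $\langle h\rangle$ the image of $\langle f\rangle$ under a fixed inversion, that is, under the reflection $x\mapsto x-\frac{2(x,n)}{(n,n)}\,n$ in a vector $n\in\mathbb R^{4,1}$ with $(n,n)\neq0$. Let $s:\Sigma^2\to S^{3,1}$ be a Ribaucour sphere congruence with two pointwise distinct envelopes $\langle f\rangle$ and $\langle h\rangle$ which are surfaces, possibly with singularities, in the sense that the points at which both are immersed are dense in $\Sigma^2$. Then: 1. $\langle f\rangle$ and $\langle h\rangle$ are Darboux transforms of each other if and only if the first derived bundle $s^{(1)}$ is flat, $R^1=0$. 2. $R^1=0$ if and only if the metric $(ds,ds)$ has constant Gauss curvature $K_{(ds,ds)}=1$. -/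

import Mathlib

open scoped Manifold ContDiff

noncomputable section

namespace SphereGeometry

/-- The vector space underlying the Lorentz space `ℝ^{4,1}`. -/
abbrev R41 : Type := Fin 5 → ℝ

/-- The Lorentz inner product of signature `(4,1)`. -/
def lor (x y : R41) : ℝ :=
  x 0 * y 0 + x 1 * y 1 + x 2 * y 2 + x 3 * y 3 - x 4 * y 4

/-- The reflection of `ℝ^{4,1}` in the hyperplane orthogonal to a non-null vector `n`: the inversion
in the sphere given by `n` (in an imaginary sphere, if `n` is timelike). -/
def inversion (n x : R41) : R41 := x - (2 * lor x n / lor n n) • n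

/-! ### Calculus in the coordinate plane

`F : ℝ² → ℝ^{4,1}` is the expression in a chart of a sphere congruence `s`. -/

/-- The coordinate plane. -/
abbrev Plane : Type := EuclideanSpace ℝ (Fin 2)

/-- The `i`-th partial derivative. -/
def pd {V : Type*} [NormedAddCommGroup V] [NormedSpace ℝ V] (i : Fin 2) (F : Plane → V)
    (y : Plane) : V :=
  fderiv ℝ F y (EuclideanSpace.single i 1)

/-- The matrix `g i j = (∂ᵢF, ∂ⱼF)` of the metric `(dF, dF)`. -/
def metric (F : Plane → R41) (y : Plane) : Matrix (Fin 2) (Fin 2) ℝ :=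
  Matrix.of fun i j => lor (pd i F y) (pd j F y)

/-- The Christoffel symbols `Γᵏᵢⱼ = ½ ∑ₗ gᵏˡ (∂ᵢ gⱼₗ + ∂ⱼ gᵢₗ - ∂ₗ gᵢⱼ)` of a metric `g` on the
coordinate plane. -/
def christoffel (g : Plane → Matrix (Fin 2) (Fin 2) ℝ) (k i j : Fin 2) (y : Plane) : ℝ :=
  (1 / 2) * ∑ l, (g y)⁻¹ k l *
    (pd i (fun z => g z j l) y + pd j (fun z => g z i l) y - pd l (fun z => g z i j) y)

/-- The component `Rˡₖᵢⱼ` of the Riemann tensor: `R(∂ᵢ, ∂ⱼ) ∂ₖ = ∑ₗ Rˡₖᵢⱼ ∂ₗ`, where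
`R(X, Y) = ∇_X ∇_Y - ∇_Y ∇_X - ∇_[X,Y]`. -/
def riemann (g : Plane → Matrix (Fin 2) (Fin 2) ℝ) (l k i j : Fin 2) (y : Plane) : ℝ :=
  pd i (christoffel g l j k) y - pd j (christoffel g l i k) y
    + ∑ m, (christoffel g l i m y * christoffel g m j k y
      - christoffel g l j m y * christoffel g m i k y)

/-- The Gauss curvature `g(R(∂₀, ∂₁) ∂₁, ∂₀) / det g`. -/
def gaussCurvature (g : Plane → Matrix (Fin 2) (Fin 2) ℝ) (y : Plane) : ℝ :=
  (∑ l, g y 0 l * riemann g l 1 0 1 y) / (g y).det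

/-- The orthogonal projection of `ℝ^{4,1}` onto the fibre `⟨F⟩ ⊕ dF(T)` at `y` of the first derived
bundle; here `(F, F) = 1` (so that `F ⊥ dF`) and `(dF, dF)` is nondegenerate. -/
def projDerived (F : Plane → R41) (y : Plane) (w : R41) : R41 :=
  lor w (F y) • F y + ∑ i, ∑ j, ((metric F y)⁻¹ i j * lor w (pd i F y)) • pd j F y

/-- The orthogonal projection onto the fibre `(⟨F⟩ ⊕ dF(T))^⊥` of the normal bundle. -/
def projNormal (F : Plane → R41) (y : Plane) (w : R41) : R41 := w - projDerived F y w

/-- The connection that the flat connection `d` of the trivial `ℝ^{4,1}`-bundle induces, through a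
field `π` of projections, on the bundle of the images of `π`: `D_i σ = π (∂ᵢ σ)`. -/
def inducedConnection (π : Plane → R41 → R41) (i : Fin 2) (σ : Plane → R41) (y : Plane) : R41 :=
  π y (pd i σ y)

/-- The induced connection on the bundle of the images of `π` is flat over `U`: its curvature
`R(∂₀, ∂₁) σ = D₀ D₁ σ - D₁ D₀ σ` vanishes for every smooth section `σ`. -/
def IsFlatOn (π : Plane → R41 → R41) (U : Set Plane) : Prop :=
  ∀ σ : Plane → R41, ContDiffOn ℝ ∞ σ U → (∀ y ∈ U, π y (σ y) = σ y) →
    ∀ y ∈ U, inducedConnection π 0 (inducedConnection π 1 σ) y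
      - inducedConnection π 1 (inducedConnection π 0 σ) y = 0

/-! ### Sphere congruences and their envelopes -/

section Surface

variable {M : Type*} [TopologicalSpace M] [ChartedSpace Plane M]

/-- The differential of a map of the surface `M` into `ℝ^{4,1}`. -/
def diff (f : M → R41) (x : M) : TangentSpace (𝓡 2) x →L[ℝ] R41 :=
  mfderiv (𝓡 2) 𝓘(ℝ, R41) f x

/-- The quadratic form `(df, df)` at a point `x`. -/
def inducedForm (f : M → R41) (x : M) (v : TangentSpace (𝓡 2) x) : ℝ :=
  lor (diff f x v) (diff f x v)

/-- `(df, df)` is positive definite at `x`. For a lift `f` of a map `⟨f⟩` into the conformal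
`3`-sphere (the projective light cone) this says that `⟨f⟩` is an immersion at `x`. -/
def IsRegularAt (f : M → R41) (x : M) : Prop :=
  ∀ v : TangentSpace (𝓡 2) x, v ≠ 0 → 0 < inducedForm f x v

/-- A regular congruence of `2`-spheres: a smooth map `s` into the Lorentz sphere
`S^{3,1} = {x | (x, x) = 1}` whose induced metric `(ds, ds)` is Riemannian. (An immersion that has
two distinct envelopes automatically has this property.) -/
structure IsSphereCongruence (s : M → R41) : Prop where
  smooth : ContMDiff (𝓡 2) 𝓘(ℝ, R41) ∞ s
  unit : ∀ x, lor (s x) (s x) = 1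
  regular : ∀ x, IsRegularAt s x

/-- `R^⊥ = 0`: the normal bundle of `s` is flat. -/
def NormalBundleFlat (s : M → R41) : Prop :=
  ∀ e ∈ atlas Plane M, IsFlatOn (projNormal (s ∘ e.symm)) e.target

/-- `R¹ = 0`: the first derived bundle `⟨s⟩ ⊕ ds(TM)` of `s` is flat. -/
def DerivedBundleFlat (s : M → R41) : Prop :=
  ∀ e ∈ atlas Plane M, IsFlatOn (projDerived (s ∘ e.symm)) e.target

/-- The Gauss curvature of `(ds, ds)` is the constant `c`. -/
def HasConstantCurvature (s : M → R41) (c : ℝ) : Prop :=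
  ∀ e ∈ atlas Plane M, ∀ y ∈ e.target, gaussCurvature (metric (s ∘ e.symm)) y = c

/-- A Ribaucour sphere congruence. -/
structure IsRibaucour (s : M → R41) : Prop extends IsSphereCongruence s where
  normal_flat : NormalBundleFlat s

/-- `f` is a smooth light cone lift of an envelope `⟨f⟩` of the sphere congruence `s`: at each `x`
the point `⟨f x⟩` lies on the sphere `s x`, and `⟨f⟩` touches that sphere there. -/
structure IsEnvelope (s f : M → R41) : Prop where
  smooth : ContMDiff (𝓡 2) 𝓘(ℝ, R41) ∞ f
  ne_zero : ∀ x, f x ≠ 0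
  null : ∀ x, lor (f x) (f x) = 0
  incident : ∀ x, lor (f x) (s x) = 0
  tangent : ∀ (x : M) (v : TangentSpace (𝓡 2) x), lor (diff f x v) (s x) = 0

/-- `⟨f⟩` and `⟨h⟩` are Darboux transforms of each other: they envelop a Ribaucour sphere
congruence, they induce conformally equivalent metrics (wherever both are immersed), and the
correspondence is not the trivial one, in which an inversion maps one surface to the other (on no
nonempty open set is `⟨h⟩` the image of `⟨f⟩` under a fixed inversion). All of this depends on the
maps `⟨f⟩` and `⟨h⟩` only, not on the lifts `f` and `h`. -/
structure AreDarbouxTransforms (f h : M → R41) : Prop where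
  distinct : ∀ x, LinearIndependent ℝ ![f x, h x]
  ribaucour : ∃ s : M → R41, IsRibaucour s ∧ IsEnvelope s f ∧ IsEnvelope s h
  conformal : ∀ x, IsRegularAt f x → IsRegularAt h x →
    ∃ c : ℝ, 0 < c ∧ ∀ v, inducedForm h x v = c * inducedForm f x v
  nontrivial : ∀ U : Set M, IsOpen U → U.Nonempty →
    ¬ ∃ n : R41, lor n n ≠ 0 ∧ ∀ x ∈ U, ∃ c : ℝ, h x = c • inversion n (f x)

end Surface

end SphereGeometry

end

open SphereGeometry

noncomputable section

namespace SphereGeometry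

/-! ### The Lorentz inner product -/

/-! In a chart let F express s, let g be its metric, and let P = (∂f, ∂F), Q = (∂h, ∂F) be the shape
forms of the envelopes. The null fields f and h span the normal bundle, so the theorem reduces to
algebra with g, P, Q at each point, plus one integration.

The curvature of the first derived bundle amounts to a single number, det II = (II₁₁, II₀₀) - (II₀₁,
II₀₁) (`isFlatOn_projDerived_iff`). Since the Lorentz sphere has curvature 1, the Gauss equation
reads K det g = det g + det II (`gauss_equation`). This gives the second claim, without envelopes.
As f and h are null, det II is (f, h)⁻¹ times the polarised determinant of P and Q
(`secondFormDet_eq`), which is det P · tr X with X = P⁻¹Q wherever P is invertible.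

Flatness of the normal bundle makes P g⁻¹ Q symmetric (`shapeForm_commute`). The envelopes induce
the metrics P g⁻¹ P and Q g⁻¹ Q = P X² g⁻¹ P. By Cayley–Hamilton these are proportional, where both
envelopes are immersed, exactly if tr X = 0 or X is scalar. The first case is flatness. If X = μ on
an open set with μ ≠ 0, then h - μf has constant direction and its inversion exchanges the envelopes
(`exists_inversion`), which nontriviality excludes. Conversely an inversion forces Q = cP with c ≠ 0
(`shapeForm_eq_smul`), which contradicts tr X = 0 where P is invertible. Density of the regular
points carries this to the whole surface. -/

lemma lor_comm (x y : R41) : lor x y = lor y x := by simp only [lor]; ring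

lemma lor_add_left (x y z : R41) : lor (x + y) z = lor x z + lor y z := by
  simp only [lor, Pi.add_apply]; ring

lemma lor_smul_left (c : ℝ) (x z : R41) : lor (c • x) z = c * lor x z := by
  simp only [lor, Pi.smul_apply, smul_eq_mul]; ring

lemma lor_add_right (x y z : R41) : lor x (y + z) = lor x y + lor x z := by
  simp only [lor, Pi.add_apply]; ring

lemma lor_smul_right (c : ℝ) (x z : R41) : lor x (c • z) = c * lor x z := by
  simp only [lor, Pi.smul_apply, smul_eq_mul]; ring

lemma lor_sub_left (x y z : R41) : lor (x - y) z = lor x z - lor y z := by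
  simp only [lor, Pi.sub_apply]; ring

lemma lor_sub_right (x y z : R41) : lor x (y - z) = lor x y - lor x z := by
  simp only [lor, Pi.sub_apply]; ring

lemma lor_zero_left (z : R41) : lor 0 z = 0 := by simp [lor]

lemma lor_zero_right (z : R41) : lor z 0 = 0 := by simp [lor]

/-- The Lorentz inner product as a continuous bilinear map. -/
def lorCLM : R41 →L[ℝ] R41 →L[ℝ] ℝ :=
  (LinearMap.mk₂ ℝ lor lor_add_left lor_smul_left lor_add_right
    lor_smul_right).toContinuousBilinearMap

lemma lorCLM_apply (x y : R41) : lorCLM x y = lor x y := rfl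

lemma eq_zero_of_lor_eq_zero {x : R41} (hx : ∀ y, lor x y = 0) : x = 0 := by
  have key : ∀ k : Fin 5, lor x (Pi.single k 1) = 0 := fun k => hx _
  ext k
  have := key k
  fin_cases k <;> simpa [lor] using this

lemma eq_zero_of_four_sq {a b c d : ℝ} (h : a ^ 2 + b ^ 2 + c ^ 2 + d ^ 2 = 0) :
    a = 0 ∧ b = 0 ∧ c = 0 ∧ d = 0 := by
  refine ⟨?_, ?_, ?_, ?_⟩ <;> rw [← sq_eq_zero_iff] <;>
    linarith [sq_nonneg a, sq_nonneg b, sq_nonneg c, sq_nonneg d]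

/-- Two linearly independent null vectors are not orthogonal. -/
lemma lor_ne_zero_of_linearIndependent {x y : R41} (hx : lor x x = 0) (hy : lor y y = 0)
    (hxy : LinearIndependent ℝ ![x, y]) : lor x y ≠ 0 := by
  intro h
  rw [LinearIndependent.pair_iff] at hxy
  simp only [lor] at hx hy h
  -- The vector y₄x - x₄y has no time component and is null, so its spatial part vanishes as well.
  have hs : (y 4 * x 0 - x 4 * y 0) ^ 2 + (y 4 * x 1 - x 4 * y 1) ^ 2
      + (y 4 * x 2 - x 4 * y 2) ^ 2 + (y 4 * x 3 - x 4 * y 3) ^ 2 = 0 := by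
    linear_combination (y 4) ^ 2 * hx + (x 4) ^ 2 * hy - 2 * x 4 * y 4 * h
  obtain ⟨h0, h1, h2, h3⟩ := eq_zero_of_four_sq hs
  obtain ⟨-, hx4⟩ := hxy (y 4) (-x 4) (by
    ext k; fin_cases k <;> simp <;> linarith)
  have hx4' : x 4 = 0 := by linarith
  have hx0 : x = 0 := by
    rw [hx4'] at hx
    obtain ⟨e0, e1, e2, e3⟩ := eq_zero_of_four_sq (a := x 0) (b := x 1) (c := x 2) (d := x 3)
      (by linarith)
    ext k; fin_cases k <;> simpa
  have := (hxy 1 0 (by simp [hx0])).1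
  norm_num at this

/-! ### Partial derivatives -/

section Calculus

variable {V : Type*} [NormedAddCommGroup V] [NormedSpace ℝ V] {U : Set Plane} {y : Plane}

lemma differentiableAt_of_contDiffOn {F : Plane → V} (hF : ContDiffOn ℝ ∞ F U)
    (hU : IsOpen U) (hy : y ∈ U) : DifferentiableAt ℝ F y :=
  (hF.contDiffAt (hU.mem_nhds hy)).differentiableAt (by simp)

lemma contDiffOn_pd {F : Plane → V} (hF : ContDiffOn ℝ ∞ F U) (hU : IsOpen U) (i : Fin 2) :
    ContDiffOn ℝ ∞ (pd i F) U :=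
  (hF.fderiv_of_isOpen hU (by simp)).clm_apply contDiffOn_const

lemma fderiv_eq_sum_pd (F : Plane → V) (y w : Plane) :
    fderiv ℝ F y w = ∑ i, w i • pd i F y := by
  have hw : w = ∑ i, w i • EuclideanSpace.single i (1 : ℝ) := by
    ext k; fin_cases k <;> simp [Fin.sum_univ_two]
  conv_lhs => rw [hw]
  simp [pd]

lemma pd_comm {F : Plane → V} (hF : ContDiffOn ℝ ∞ F U) (hU : IsOpen U) (hy : y ∈ U)
    (i j : Fin 2) : pd i (pd j F) y = pd j (pd i F) y := by
  have hF' : DifferentiableAt ℝ (fderiv ℝ F) y :=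
    differentiableAt_of_contDiffOn (hF.fderiv_of_isOpen hU (by simp)) hU hy
  have key : ∀ i j : Fin 2, pd i (pd j F) y = fderiv ℝ (fderiv ℝ F) y
      (EuclideanSpace.single i 1) (EuclideanSpace.single j 1) := by
    intro i j
    unfold pd
    rw [fderiv_clm_apply hF' (differentiableAt_const _)]
    simp
  rw [key, key]
  exact (hF.contDiffAt (hU.mem_nhds hy)).isSymmSndFDerivAt
    (by rw [minSmoothness_of_isRCLikeNormedField]; exact WithTop.coe_le_coe.2 (le_top : (2 : ℕ∞) ≤ ⊤)) _ _

lemma pd_congr {F G : Plane → V} (h : Set.EqOn F G U) (hU : IsOpen U) (hy : y ∈ U) (i : Fin 2) :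
    pd i F y = pd i G y := by
  unfold pd
  rw [Filter.EventuallyEq.fderiv_eq (h.eventuallyEq_of_mem (hU.mem_nhds hy))]

lemma pd_add {F G : Plane → V} (hF : DifferentiableAt ℝ F y) (hG : DifferentiableAt ℝ G y)
    (i : Fin 2) : pd i (fun z => F z + G z) y = pd i F y + pd i G y := by
  simp [pd, fderiv_fun_add hF hG]

lemma pd_sub {F G : Plane → V} (hF : DifferentiableAt ℝ F y) (hG : DifferentiableAt ℝ G y)
    (i : Fin 2) : pd i (fun z => F z - G z) y = pd i F y - pd i G y := by
  simp [pd, fderiv_fun_sub hF hG]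

lemma pd_smul {c : Plane → ℝ} {F : Plane → V} (hc : DifferentiableAt ℝ c y)
    (hF : DifferentiableAt ℝ F y) (i : Fin 2) :
    pd i (fun z => c z • F z) y = pd i c y • F y + c y • pd i F y := by
  simp [pd, fderiv_fun_smul hc hF, add_comm]

lemma pd_const (c : V) (i : Fin 2) : pd i (fun _ => c) y = 0 := by simp [pd]

lemma pd_lor {a b : Plane → R41} (ha : DifferentiableAt ℝ a y) (hb : DifferentiableAt ℝ b y)
    (i : Fin 2) :
    pd i (fun z => lor (a z) (b z)) y = lor (pd i a y) (b y) + lor (a y) (pd i b y) := by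
  have := lorCLM.fderiv_of_bilinear ha hb
  simp only [lorCLM_apply] at this
  simp [pd, this, lorCLM_apply, add_comm]

lemma contDiffOn_lor {a b : Plane → R41} (ha : ContDiffOn ℝ ∞ a U) (hb : ContDiffOn ℝ ∞ b U) :
    ContDiffOn ℝ ∞ (fun z => lor (a z) (b z)) U :=
  (lorCLM.contDiff.comp_contDiffOn ha).clm_apply hb

/-- Orthogonality of two smooth maps, differentiated. -/
lemma lor_pd_eq_neg {a b : Plane → R41} (ha : ContDiffOn ℝ ∞ a U) (hb : ContDiffOn ℝ ∞ b U)
    (hU : IsOpen U) {c : ℝ} (hab : ∀ z ∈ U, lor (a z) (b z) = c) (hy : y ∈ U) (i : Fin 2) :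
    lor (pd i a y) (b y) = - lor (a y) (pd i b y) := by
  have h1 := pd_lor (differentiableAt_of_contDiffOn ha hU hy)
    (differentiableAt_of_contDiffOn hb hU hy) i
  have h2 : pd i (fun z => lor (a z) (b z)) y = pd i (fun _ => c) y :=
    pd_congr hab hU hy i
  rw [h2, pd_const] at h1
  linarith

end Calculus

/-! ### Immersions into the Lorentz sphere -/

/-- `F` is a smooth map of an open set of the coordinate plane into the Lorentz sphere, whose
induced metric is nondegenerate. -/
structure IsUnitImmersionOn (U : Set Plane) (F : Plane → R41) : Prop where
  isOpen : IsOpen U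
  smooth : ContDiffOn ℝ ∞ F U
  unit : ∀ y ∈ U, lor (F y) (F y) = 1
  det_ne : ∀ y ∈ U, (metric F y).det ≠ 0

lemma metric_apply (F : Plane → R41) (y : Plane) (i j : Fin 2) :
    metric F y i j = lor (pd i F y) (pd j F y) := rfl

lemma metric_symm (F : Plane → R41) (y : Plane) (i j : Fin 2) :
    metric F y i j = metric F y j i := lor_comm _ _

lemma metric_inv_apply (F : Plane → R41) (y : Plane) (i j : Fin 2) :
    (metric F y)⁻¹ i j = (metric F y).det⁻¹ * (metric F y).adjugate i j := by
  simp [Matrix.inv_def]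

lemma metric_inv_symm (F : Plane → R41) (y : Plane) (i j : Fin 2) :
    (metric F y)⁻¹ i j = (metric F y)⁻¹ j i := by
  have h : (metric F y).transpose = metric F y := Matrix.ext fun i j => metric_symm F y j i
  conv_lhs => rw [← h, ← Matrix.transpose_nonsing_inv, Matrix.transpose_apply]

lemma projDerived_sub (F : Plane → R41) (y : Plane) (v w : R41) :
    projDerived F y (v - w) = projDerived F y v - projDerived F y w := by
  simp only [projDerived, lor_sub_left, Fin.sum_univ_two]; module

/-- Only the symmetry of the inverse Gram matrix enters, so self-adjointness needs no nondegeneracy.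
-/
lemma lor_projDerived_comm (F : Plane → R41) (y : Plane) (v w : R41) :
    lor (projDerived F y v) w = lor v (projDerived F y w) := by
  have h : ∀ k, lor (pd k F y) w = lor w (pd k F y) := fun k => lor_comm _ _
  simp only [projDerived, Fin.sum_univ_two, lor_add_left, lor_add_right, lor_smul_left,
    lor_smul_right, metric_inv_symm F y 1 0, h, lor_comm (F y) w]
  ring

lemma projDerived_eq_zero {F : Plane → R41} {y : Plane} {w : R41} (h0 : lor w (F y) = 0)
    (h : ∀ k, lor w (pd k F y) = 0) : projDerived F y w = 0 := by
  simp [projDerived, h0, h]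

namespace IsUnitImmersionOn

variable {U : Set Plane} {F : Plane → R41} {y : Plane}

lemma lor_pd_self (hF : IsUnitImmersionOn U F) (hy : y ∈ U) (i : Fin 2) :
    lor (pd i F y) (F y) = 0 := by
  have := lor_pd_eq_neg hF.smooth hF.smooth hF.isOpen hF.unit hy i
  rw [lor_comm (F y)] at this
  linarith

lemma inv_mul_metric (hF : IsUnitImmersionOn U F) (hy : y ∈ U) (i k : Fin 2) :
    ∑ j, (metric F y)⁻¹ i j * metric F y j k = if i = k then 1 else 0 := by
  rw [← Matrix.mul_apply, Matrix.nonsing_inv_mul _ (hF.det_ne y hy).isUnit, Matrix.one_apply]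

lemma projDerived_self (hF : IsUnitImmersionOn U F) (hy : y ∈ U) :
    projDerived F y (F y) = F y := by
  simp [projDerived, hF.unit y hy, lor_comm (F y) (pd _ F y), hF.lor_pd_self hy]

lemma projDerived_pd (hF : IsUnitImmersionOn U F) (hy : y ∈ U) (k : Fin 2) :
    projDerived F y (pd k F y) = pd k F y := by
  have h : ∀ j, ∑ i, (metric F y)⁻¹ i j * lor (pd k F y) (pd i F y) = if j = k then 1 else 0 := by
    intro j
    rw [← hF.inv_mul_metric hy j k]
    exact Finset.sum_congr rfl fun i _ => by
      rw [metric_inv_symm, metric_apply, lor_comm (pd k F y)]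
  rw [projDerived, hF.lor_pd_self hy, Finset.sum_comm]
  simp only [← Finset.sum_smul, h]
  simp

lemma lor_projDerived_self (hF : IsUnitImmersionOn U F) (hy : y ∈ U) (w : R41) :
    lor (projDerived F y w) (F y) = lor w (F y) := by
  rw [lor_projDerived_comm, hF.projDerived_self hy]

lemma lor_projDerived_pd (hF : IsUnitImmersionOn U F) (hy : y ∈ U) (w : R41) (k : Fin 2) :
    lor (projDerived F y w) (pd k F y) = lor w (pd k F y) := by
  rw [lor_projDerived_comm, hF.projDerived_pd hy]

lemma projDerived_projDerived (hF : IsUnitImmersionOn U F) (hy : y ∈ U) (w : R41) :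
    projDerived F y (projDerived F y w) = projDerived F y w := by
  rw [← sub_eq_zero, ← projDerived_sub]
  refine projDerived_eq_zero ?_ fun k => ?_
  · rw [lor_sub_left, hF.lor_projDerived_self hy, sub_self]
  · rw [lor_sub_left, hF.lor_projDerived_pd hy, sub_self]

lemma projDerived_projNormal (hF : IsUnitImmersionOn U F) (hy : y ∈ U) (w : R41) :
    projDerived F y (projNormal F y w) = 0 := by
  rw [projNormal, projDerived_sub, hF.projDerived_projDerived hy, sub_self]

lemma lor_projNormal_self (hF : IsUnitImmersionOn U F) (hy : y ∈ U) (w : R41) :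
    lor (projNormal F y w) (F y) = 0 := by
  rw [projNormal, lor_sub_left, hF.lor_projDerived_self hy, sub_self]

lemma lor_projNormal_pd (hF : IsUnitImmersionOn U F) (hy : y ∈ U) (w : R41) (k : Fin 2) :
    lor (projNormal F y w) (pd k F y) = 0 := by
  rw [projNormal, lor_sub_left, hF.lor_projDerived_pd hy, sub_self]

lemma lor_projNormal_left (hF : IsUnitImmersionOn U F) (hy : y ∈ U) (v w : R41) :
    lor (projNormal F y v) w = lor (projNormal F y v) (projNormal F y w) := by
  conv_rhs => rw [projNormal.eq_1 F y w, lor_sub_right, ← lor_projDerived_comm,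
    hF.projDerived_projNormal hy, lor_zero_left, sub_zero]

/-- A vector of the derived bundle vanishes if it is orthogonal to the frame `F, ∂₀F, ∂₁F`. -/
lemma eq_zero_of_projDerived {w : R41} (hw : projDerived F y w = w)
    (h0 : lor w (F y) = 0) (h : ∀ k, lor w (pd k F y) = 0) : w = 0 := by
  rw [← hw, projDerived_eq_zero h0 h]

lemma contDiffOn_metric (hF : IsUnitImmersionOn U F) (i j : Fin 2) :
    ContDiffOn ℝ ∞ (fun y => metric F y i j) U :=
  contDiffOn_lor (contDiffOn_pd hF.smooth hF.isOpen i) (contDiffOn_pd hF.smooth hF.isOpen j)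

lemma contDiffOn_metric_inv (hF : IsUnitImmersionOn U F) (i j : Fin 2) :
    ContDiffOn ℝ ∞ (fun y => (metric F y)⁻¹ i j) U := by
  have hdet : ContDiffOn ℝ ∞ (fun y => (metric F y).det) U := by
    simp only [Matrix.det_fin_two]
    exact ((hF.contDiffOn_metric 0 0).mul (hF.contDiffOn_metric 1 1)).sub
      ((hF.contDiffOn_metric 0 1).mul (hF.contDiffOn_metric 1 0))
  simp only [metric_inv_apply]
  refine (hdet.inv hF.det_ne).mul ?_
  simp only [Matrix.adjugate_fin_two]
  fin_cases i <;> fin_cases j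
  · exact hF.contDiffOn_metric 1 1
  · exact (hF.contDiffOn_metric 0 1).neg
  · exact (hF.contDiffOn_metric 1 0).neg
  · exact hF.contDiffOn_metric 0 0

lemma contDiffOn_projDerived (hF : IsUnitImmersionOn U F) {σ : Plane → R41}
    (hσ : ContDiffOn ℝ ∞ σ U) : ContDiffOn ℝ ∞ (fun y => projDerived F y (σ y)) U := by
  unfold projDerived
  refine ((contDiffOn_lor hσ hF.smooth).smul hF.smooth).add ?_
  refine ContDiffOn.sum fun i _ => ContDiffOn.sum fun j _ => ?_
  exact ((hF.contDiffOn_metric_inv i j).mul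
    (contDiffOn_lor hσ (contDiffOn_pd hF.smooth hF.isOpen i))).smul
    (contDiffOn_pd hF.smooth hF.isOpen j)

lemma contDiffOn_projNormal (hF : IsUnitImmersionOn U F) {σ : Plane → R41}
    (hσ : ContDiffOn ℝ ∞ σ U) : ContDiffOn ℝ ∞ (fun y => projNormal F y (σ y)) U :=
  hσ.sub (hF.contDiffOn_projDerived hσ)

end IsUnitImmersionOn

/-! ### Curvature of induced connections -/

/-- `R(∂₀, ∂₁) σ` for the connection induced by the projections `π`. -/
def inducedCurvature (π : Plane → R41 → R41) (σ : Plane → R41) (y : Plane) : R41 :=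
  inducedConnection π 0 (inducedConnection π 1 σ) y
    - inducedConnection π 1 (inducedConnection π 0 σ) y

/-- The curvature of an induced connection, in terms of the components of the derivatives of the
sections which the projections remove. -/
lemma lor_inducedCurvature {U : Set Plane} (hU : IsOpen U) {π : Plane → R41 → R41}
    (hπ : ∀ τ : Plane → R41, ContDiffOn ℝ ∞ τ U → ContDiffOn ℝ ∞ (fun y => π y (τ y)) U)
    {σ η : Plane → R41} (hσ : ContDiffOn ℝ ∞ σ U) (hη : ContDiffOn ℝ ∞ η U)
    (hπη : ∀ y ∈ U, ∀ w, lor (π y w) (η y) = lor w (η y)) {y : Plane} (hy : y ∈ U) :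
    lor (inducedCurvature π σ y) (η y) =
      lor (pd 1 σ y - π y (pd 1 σ y)) (pd 0 η y)
        - lor (pd 0 σ y - π y (pd 0 σ y)) (pd 1 η y) := by
  have hs : ∀ i, ContDiffOn ℝ ∞ (pd i σ) U := contDiffOn_pd hσ hU
  have hD : ∀ i, ContDiffOn ℝ ∞ (fun z => π z (pd i σ z)) U := fun i => hπ _ (hs i)
  -- The removed part ∂ⱼσ - π∂ⱼσ is orthogonal to η; differentiate this relation. The second
  -- derivatives of σ then cancel on antisymmetrising.
  have key : ∀ i j, lor (pd i (fun z => π z (pd j σ z)) y) (η y)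
      = lor (pd i (pd j σ) y) (η y) + lor (pd j σ y - π y (pd j σ y)) (pd i η y) := by
    intro i j
    have h1 := lor_pd_eq_neg ((hs j).sub (hD j)) hη hU (c := 0) (fun z hz => by
      rw [lor_sub_left, hπη z hz, sub_self]) hy i
    rw [pd_sub (differentiableAt_of_contDiffOn (hs j) hU hy)
      (differentiableAt_of_contDiffOn (hD j) hU hy), lor_sub_left] at h1
    linarith
  simp only [inducedCurvature, inducedConnection, lor_sub_left, hπη y hy]
  change lor (pd 0 (fun z => π z (pd 1 σ z)) y) (η y)
    - lor (pd 1 (fun z => π z (pd 0 σ z)) y) (η y) = _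
  rw [key, key, pd_comm hσ hU hy 0 1, lor_sub_left, lor_sub_left]
  ring

/-- The second fundamental form `(∂ᵢ∂ⱼF)^⊥` with values in the normal bundle. -/
def secondForm (F : Plane → R41) (i j : Fin 2) (y : Plane) : R41 :=
  projNormal F y (pd i (pd j F) y)

/-- The determinant `(II₁₁, II₀₀) - (II₀₁, II₀₁)` of the second fundamental form. -/
def secondFormDet (F : Plane → R41) (y : Plane) : ℝ :=
  lor (secondForm F 1 1 y) (secondForm F 0 0 y) - lor (secondForm F 0 1 y) (secondForm F 0 1 y)

namespace IsUnitImmersionOn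

variable {U : Set Plane} {F : Plane → R41} {y : Plane}

/-- The part of a derivative that `projDerived` removes is normal, so only the normal parts of ∂σ
and ∂η can enter. -/
lemma lor_curvature_projDerived (hF : IsUnitImmersionOn U F) {σ η : Plane → R41}
    (hσ : ContDiffOn ℝ ∞ σ U) (hη : ContDiffOn ℝ ∞ η U)
    (hFη : ∀ y ∈ U, projDerived F y (η y) = η y) (hy : y ∈ U) :
    lor (inducedCurvature (projDerived F) σ y) (η y) =
      lor (projNormal F y (pd 1 σ y)) (projNormal F y (pd 0 η y))
        - lor (projNormal F y (pd 0 σ y)) (projNormal F y (pd 1 η y)) := by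
  rw [lor_inducedCurvature hF.isOpen (fun _ hτ => hF.contDiffOn_projDerived hτ) hσ hη
    (fun z hz w => by rw [lor_projDerived_comm, hFη z hz]) hy,
    ← hF.lor_projNormal_left hy, ← hF.lor_projNormal_left hy]
  rfl

lemma projNormal_pd (hF : IsUnitImmersionOn U F) (hy : y ∈ U) (k : Fin 2) :
    projNormal F y (pd k F y) = 0 := by
  rw [projNormal, hF.projDerived_pd hy, sub_self]

lemma secondForm_symm (hF : IsUnitImmersionOn U F) (hy : y ∈ U) (i j : Fin 2) :
    secondForm F i j y = secondForm F j i y := by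
  rw [secondForm, secondForm, pd_comm hF.smooth hF.isOpen hy]

lemma lor_curvature_pd (hF : IsUnitImmersionOn U F) (hy : y ∈ U) (j k : Fin 2) :
    lor (inducedCurvature (projDerived F) (pd j F) y) (pd k F y) =
      lor (secondForm F 1 j y) (secondForm F 0 k y)
        - lor (secondForm F 0 j y) (secondForm F 1 k y) :=
  hF.lor_curvature_projDerived (contDiffOn_pd hF.smooth hF.isOpen j)
    (contDiffOn_pd hF.smooth hF.isOpen k) (fun _ hz => hF.projDerived_pd hz k) hy

/-- The derivatives of F lie in the derived bundle, so the direction F contributes no curvature. -/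
lemma lor_curvature_self (hF : IsUnitImmersionOn U F) {σ : Plane → R41}
    (hσ : ContDiffOn ℝ ∞ σ U) (hy : y ∈ U) :
    lor (inducedCurvature (projDerived F) σ y) (F y) = 0 := by
  rw [hF.lor_curvature_projDerived hσ hF.smooth (fun _ hz => hF.projDerived_self hz) hy,
    hF.projNormal_pd hy, hF.projNormal_pd hy, lor_zero_right, lor_zero_right, sub_self]

lemma projDerived_curvature (hF : IsUnitImmersionOn U F) (hy : y ∈ U) (σ : Plane → R41) :
    projDerived F y (inducedCurvature (projDerived F) σ y)
      = inducedCurvature (projDerived F) σ y := by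
  simp only [inducedCurvature, projDerived_sub]
  congr 1 <;> exact hF.projDerived_projDerived hy _

/-- The first derived bundle is flat if and only if the second fundamental form has determinant
zero. -/
lemma isFlatOn_projDerived_iff (hF : IsUnitImmersionOn U F) :
    IsFlatOn (projDerived F) U ↔ ∀ y ∈ U, secondFormDet F y = 0 := by
  constructor
  · intro hflat y hy
    have h := hF.lor_curvature_pd hy 1 0
    have h0 : inducedCurvature (projDerived F) (pd 1 F) y = 0 :=
      hflat _ (contDiffOn_pd hF.smooth hF.isOpen 1) (fun _ hz => hF.projDerived_pd hz 1) y hy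
    rw [h0, lor_zero_left, hF.secondForm_symm hy 1 0] at h
    exact h.symm
  · intro hdet σ hσ hσF y hy
    have hd := hdet y hy
    rw [secondFormDet] at hd
    -- On the frame fields ∂ₖF every curvature component is zero identically or is ± the
    -- determinant.
    have hpd : ∀ k, inducedCurvature (projDerived F) (pd k F) y = 0 := by
      intro k
      refine eq_zero_of_projDerived (hF.projDerived_curvature hy _)
        (hF.lor_curvature_self (contDiffOn_pd hF.smooth hF.isOpen k) hy) fun l => ?_
      rw [hF.lor_curvature_pd hy]
      fin_cases k <;> fin_cases l <;>
        simp only [Fin.zero_eta, Fin.mk_one, hF.secondForm_symm hy 1 0]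
      · rw [lor_comm]; ring
      · rw [lor_comm (secondForm F 0 0 y)]; linarith
      · exact hd
      · rw [lor_comm]; ring
    refine eq_zero_of_projDerived (hF.projDerived_curvature hy σ)
      (hF.lor_curvature_self hσ hy) fun k => ?_
    -- A general section follows by skew-symmetry, (R σ, ∂ₖF) = -(R ∂ₖF, σ), so σ need not be
    -- expanded in the frame.
    have h1 := hF.lor_curvature_projDerived hσ (contDiffOn_pd hF.smooth hF.isOpen k)
      (fun _ hz => hF.projDerived_pd hz k) hy
    have h2 := hF.lor_curvature_projDerived (contDiffOn_pd hF.smooth hF.isOpen k) hσ hσF hy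
    rw [hpd, lor_zero_left, lor_comm _ (projNormal F y (pd 0 σ y)),
      lor_comm _ (projNormal F y (pd 1 σ y))] at h2
    change lor (inducedCurvature (projDerived F) σ y) (pd k F y) = 0
    linarith

/-! ### The Gauss equation -/

/-- After expanding ∂ᵢgⱼₗ by the product rule, symmetry of second derivatives leaves only (∂ᵢ∂ⱼF,
∂ₗF) in the Koszul combination. -/
lemma christoffel_eq (hF : IsUnitImmersionOn U F) (hy : y ∈ U) (k i j : Fin 2) :
    christoffel (metric F) k i j y
      = ∑ l, (metric F y)⁻¹ k l * lor (pd i (pd j F) y) (pd l F y) := by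
  have hd : ∀ a, DifferentiableAt ℝ (pd a F) y := fun a =>
    differentiableAt_of_contDiffOn (contDiffOn_pd hF.smooth hF.isOpen a) hF.isOpen hy
  have hg : ∀ i a b, pd i (fun z => metric F z a b) y
      = lor (pd i (pd a F) y) (pd b F y) + lor (pd i (pd b F) y) (pd a F y) := by
    intro i a b
    rw [lor_comm (pd i (pd b F) y)]
    exact pd_lor (hd a) (hd b) i
  rw [christoffel, Finset.mul_sum]
  refine Finset.sum_congr rfl fun l _ => ?_
  rw [hg, hg, hg, pd_comm hF.smooth hF.isOpen hy j i, pd_comm hF.smooth hF.isOpen hy l i,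
    pd_comm hF.smooth hF.isOpen hy l j]
  ring

/-- This is the umbilicity of the Lorentz sphere in its ambient space, the source of the term det g
in the Gauss equation. -/
lemma lor_pd_pd_self (hF : IsUnitImmersionOn U F) (hy : y ∈ U) (i j : Fin 2) :
    lor (pd i (pd j F) y) (F y) = - metric F y j i := by
  rw [lor_pd_eq_neg (contDiffOn_pd hF.smooth hF.isOpen j) hF.smooth hF.isOpen
    (fun z hz => hF.lor_pd_self hz j) hy, metric_apply]

lemma projDerived_pd_pd (hF : IsUnitImmersionOn U F) (hy : y ∈ U) (i j : Fin 2) :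
    projDerived F y (pd i (pd j F) y)
      = (∑ k, christoffel (metric F) k i j y • pd k F y) - metric F y i j • F y := by
  simp only [hF.christoffel_eq hy, projDerived, hF.lor_pd_pd_self hy, Fin.sum_univ_two,
    metric_symm F y j i, metric_inv_symm F y 1 0]
  module

lemma contDiffOn_christoffel (hF : IsUnitImmersionOn U F) (k i j : Fin 2) :
    ContDiffOn ℝ ∞ (christoffel (metric F) k i j) U := by
  refine ContDiffOn.congr ?_ fun z hz => hF.christoffel_eq hz k i j
  exact ContDiffOn.sum fun l _ => (hF.contDiffOn_metric_inv k l).mul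
    (contDiffOn_lor (contDiffOn_pd (contDiffOn_pd hF.smooth hF.isOpen j) hF.isOpen i)
      (contDiffOn_pd hF.smooth hF.isOpen l))

/-- Differentiate Γᵏᵢⱼ∂ₖF - gᵢⱼF and keep the tangential part. The Γ terms antisymmetrise to the
Riemann tensor and the last term to -det g. -/
lemma lor_pd_projDerived_pd_pd (hF : IsUnitImmersionOn U F) (hy : y ∈ U) (a i j l : Fin 2) :
    lor (pd a (fun z => projDerived F z (pd i (pd j F) z)) y) (pd l F y)
      = (∑ k, pd a (christoffel (metric F) k i j) y * metric F y k l)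
        + (∑ k, christoffel (metric F) k i j y *
            ∑ m, christoffel (metric F) m a k y * metric F y m l)
        - metric F y i j * metric F y a l := by
  have hd : ∀ a, DifferentiableAt ℝ (pd a F) y := fun a =>
    differentiableAt_of_contDiffOn (contDiffOn_pd hF.smooth hF.isOpen a) hF.isOpen hy
  have hF' := differentiableAt_of_contDiffOn hF.smooth hF.isOpen hy
  have hc : ∀ k, DifferentiableAt ℝ (christoffel (metric F) k i j) y := fun k =>
    differentiableAt_of_contDiffOn (hF.contDiffOn_christoffel k i j) hF.isOpen hy
  have hm : DifferentiableAt ℝ (fun z => metric F z i j) y :=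
    differentiableAt_of_contDiffOn (hF.contDiffOn_metric i j) hF.isOpen hy
  have hpd : ∀ k, lor (pd a (pd k F) y) (pd l F y)
      = ∑ m, christoffel (metric F) m a k y * metric F y m l := by
    intro k
    rw [← hF.lor_projDerived_pd hy, hF.projDerived_pd_pd hy]
    simp only [Fin.sum_univ_two, lor_sub_left, lor_add_left, lor_smul_left, lor_comm (F y),
      hF.lor_pd_self hy, metric_apply]
    ring
  rw [pd_congr (G := fun z => (christoffel (metric F) 0 i j z • pd 0 F z
      + christoffel (metric F) 1 i j z • pd 1 F z) - metric F z i j • F z)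
      (fun z hz => by rw [hF.projDerived_pd_pd hz, Fin.sum_univ_two]) hF.isOpen hy,
    pd_sub (((hc 0).fun_smul (hd 0)).fun_add ((hc 1).fun_smul (hd 1))) (hm.fun_smul hF'),
    pd_add ((hc 0).fun_smul (hd 0)) ((hc 1).fun_smul (hd 1)), pd_smul (hc 0) (hd 0),
    pd_smul (hc 1) (hd 1), pd_smul hm hF']
  simp only [lor_sub_left, lor_add_left, lor_smul_left, hpd, lor_comm (F y),
    hF.lor_pd_self hy, Fin.sum_univ_two, ← metric_apply]
  ring

/-- The Gauss equation. -/
lemma gauss_equation (hF : IsUnitImmersionOn U F) (hy : y ∈ U) :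
    ∑ l, metric F y 0 l * riemann (metric F) l 1 0 1 y
      = (metric F y).det + secondFormDet F y := by
  -- The component (R(∂₀, ∂₁)∂₁F, ∂₀F) is computed twice: through the second fundamental form and
  -- through the Christoffel symbols.
  have h := hF.lor_curvature_pd hy 1 0
  simp only [inducedCurvature, inducedConnection, lor_sub_left, hF.lor_projDerived_pd hy] at h
  have h' : lor (pd 0 (fun z => projDerived F z (pd 1 (pd 1 F) z)) y) (pd 0 F y)
      - lor (pd 1 (fun z => projDerived F z (pd 0 (pd 1 F) z)) y) (pd 0 F y)
      = secondFormDet F y := by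
    rw [hF.secondForm_symm hy 1 0] at h
    exact h
  rw [hF.lor_pd_projDerived_pd_pd hy, hF.lor_pd_projDerived_pd_pd hy] at h'
  rw [← h', Matrix.det_fin_two]
  simp only [riemann, Fin.sum_univ_two, metric_symm F y 1 0]
  ring

lemma gaussCurvature_eq_one_iff (hF : IsUnitImmersionOn U F) (hy : y ∈ U) :
    gaussCurvature (metric F) y = 1 ↔ secondFormDet F y = 0 := by
  rw [gaussCurvature, hF.gauss_equation hy, div_eq_one_iff_eq (hF.det_ne y hy), add_eq_left]

end IsUnitImmersionOn

/-! ### Pairs of symmetric `2 × 2` matrices -/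

/-- The polarisation `tr (adj P * Q)` of twice the determinant. -/
def mixedDet (P Q : Matrix (Fin 2) (Fin 2) ℝ) : ℝ :=
  P 0 0 * Q 1 1 + P 1 1 * Q 0 0 - P 0 1 * Q 1 0 - P 1 0 * Q 0 1

lemma mixedDet_smul_self (c : ℝ) (P : Matrix (Fin 2) (Fin 2) ℝ) :
    mixedDet P (c • P) = 2 * c * P.det := by
  simp only [mixedDet, Matrix.det_fin_two, Matrix.smul_apply, smul_eq_mul]; ring

/-- For invertible P this turns apolarity of P and Q into vanishing trace of P⁻¹Q. -/
lemma det_mul_trace_inv_mul {P : Matrix (Fin 2) (Fin 2) ℝ} (hP : P.det ≠ 0)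
    (Q : Matrix (Fin 2) (Fin 2) ℝ) : P.det * (P⁻¹ * Q).trace = mixedDet P Q := by
  rw [Matrix.inv_def, Matrix.smul_mul, Matrix.trace_smul, Ring.inverse_eq_inv', smul_eq_mul,
    mul_inv_cancel_left₀ hP]
  simp only [Matrix.adjugate_fin_two, Matrix.trace_fin_two, Matrix.mul_apply, Fin.sum_univ_two,
    mixedDet]
  simp
  ring

lemma mul_self_fin_two (X : Matrix (Fin 2) (Fin 2) ℝ) :
    X * X = X.trace • X - X.det • (1 : Matrix (Fin 2) (Fin 2) ℝ) := by
  ext i j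
  fin_cases i <;> fin_cases j <;>
    simp [Matrix.mul_apply, Fin.sum_univ_two, Matrix.trace_fin_two, Matrix.det_fin_two] <;> ring

/-- With X = P⁻¹Q the commutation relation says XGP = GQ, hence QGQ = (PX)(XGP). -/
lemma mul_mul_self_eq_of_commute {G P Q : Matrix (Fin 2) (Fin 2) ℝ} (hP : P.det ≠ 0)
    (hcomm : P * G * Q = Q * G * P) :
    Q * G * Q = P * (P⁻¹ * Q * (P⁻¹ * Q)) * (G * P) := by
  have h1 : P * (P⁻¹ * Q) = Q := Matrix.mul_nonsing_inv_cancel_left _ _ hP.isUnit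
  have h2 : P⁻¹ * Q * (G * P) = G * Q := by
    rw [Matrix.mul_assoc, ← Matrix.mul_assoc Q, ← hcomm, Matrix.mul_assoc,
      Matrix.nonsing_inv_mul_cancel_left _ _ hP.isUnit]
  rw [← Matrix.mul_assoc P, h1, Matrix.mul_assoc Q (P⁻¹ * Q), h2, Matrix.mul_assoc]

/-- If `P * G * Q` is symmetric and `P` and `Q` are apolar, then `Q * G * Q` and `P * G * P` are
proportional. -/
lemma exists_smul_of_mixedDet_eq_zero {G P Q : Matrix (Fin 2) (Fin 2) ℝ} (hP : P.det ≠ 0)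
    (hcomm : P * G * Q = Q * G * P) (hm : mixedDet P Q = 0) :
    ∃ c : ℝ, Q * G * Q = c • (P * G * P) := by
  have ht : (P⁻¹ * Q).trace = 0 := by
    have := det_mul_trace_inv_mul hP Q
    rw [hm] at this
    exact (mul_eq_zero.1 this).resolve_left hP
  -- A trace-free X satisfies X² = -det X by Cayley–Hamilton.
  refine ⟨-(P⁻¹ * Q).det, ?_⟩
  rw [mul_mul_self_eq_of_commute hP hcomm, mul_self_fin_two (P⁻¹ * Q), ht, zero_smul, zero_sub,
    ← neg_smul, Matrix.mul_smul, Matrix.smul_mul, Matrix.mul_one, Matrix.mul_assoc]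

/-- If `P * G * Q` is symmetric and `Q * G * Q` and `P * G * P` are proportional, then `P` and `Q`
are apolar or proportional. -/
lemma eq_smul_of_mixedDet_ne_zero {G P Q : Matrix (Fin 2) (Fin 2) ℝ} (hP : P.det ≠ 0)
    (hG : G.det ≠ 0) (hcomm : P * G * Q = Q * G * P) {c : ℝ}
    (hc : Q * G * Q = c • (P * G * P)) (hm : mixedDet P Q ≠ 0) :
    Q = (mixedDet P Q / (2 * P.det)) • P := by
  set X := P⁻¹ * Q
  have hPX : P * X = Q := Matrix.mul_nonsing_inv_cancel_left _ _ hP.isUnit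
  have htr : P.det * X.trace = mixedDet P Q := det_mul_trace_inv_mul hP Q
  have ht : X.trace ≠ 0 := by
    intro h
    rw [h, mul_zero] at htr
    exact hm htr.symm
  have hGP : (G * P).det ≠ 0 := by rw [Matrix.det_mul]; exact mul_ne_zero hG hP
  have hXX : X * X = c • (1 : Matrix (Fin 2) (Fin 2) ℝ) := by
    have h1 : P * (X * X) * (G * P) = P * (c • (1 : Matrix (Fin 2) (Fin 2) ℝ)) * (G * P) := by
      rw [← mul_mul_self_eq_of_commute hP hcomm, hc, Matrix.mul_smul, Matrix.smul_mul,
        Matrix.mul_one, Matrix.mul_assoc]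
    have h2 := congrArg (· * (G * P)⁻¹) h1
    simp only [Matrix.mul_nonsing_inv_cancel_right _ _ hGP.isUnit] at h2
    have h3 := congrArg (P⁻¹ * ·) h2
    simpa only [Matrix.nonsing_inv_mul_cancel_left _ _ hP.isUnit] using h3
  -- Cayley–Hamilton now reads tr X · X = (c + det X) · 1, and tr X ≠ 0 makes X scalar.
  rw [mul_self_fin_two X, sub_eq_iff_eq_add, ← add_smul] at hXX
  have hXs : X = ((c + X.det) / X.trace) • (1 : Matrix (Fin 2) (Fin 2) ℝ) := by
    rw [div_eq_inv_mul, mul_smul, ← hXX, smul_smul, inv_mul_cancel₀ ht, one_smul]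
  have hQ : Q = ((c + X.det) / X.trace) • P := by
    rw [← hPX]
    conv_lhs => rw [hXs]
    rw [Matrix.mul_smul, Matrix.mul_one]
  generalize (c + X.det) / X.trace = μ at hQ
  -- The factor is rewritten through P and Q alone, a form that is visibly smooth when P and Q vary
  -- with the point.
  have hμ : mixedDet P Q / (2 * P.det) = μ := by
    rw [hQ, mixedDet_smul_self]
    field_simp
  rw [hμ]
  exact hQ

/-! ### Envelopes in coordinates -/

/-- `f` is a light cone lift of an envelope of `F`, in coordinates. -/
structure IsEnvelopeOn (U : Set Plane) (F f : Plane → R41) : Prop where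
  smooth : ContDiffOn ℝ ∞ f U
  null : ∀ y ∈ U, lor (f y) (f y) = 0
  incident : ∀ y ∈ U, lor (f y) (F y) = 0
  tangent : ∀ y ∈ U, ∀ i, lor (pd i f y) (F y) = 0

/-- The second fundamental form `(∂ᵢf, ∂ⱼF) = -(f, ∂ᵢ∂ⱼF)` in the direction of a normal field. -/
def shapeForm (F f : Plane → R41) (y : Plane) : Matrix (Fin 2) (Fin 2) ℝ :=
  Matrix.of fun i j => lor (pd i f y) (pd j F y)

lemma shapeForm_apply (F f : Plane → R41) (y : Plane) (i j : Fin 2) :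
    shapeForm F f y i j = lor (pd i f y) (pd j F y) := rfl

section Envelope

variable {U : Set Plane} {F f h : Plane → R41} {y : Plane}

namespace IsEnvelopeOn

lemma lor_pd (hF : IsUnitImmersionOn U F) (hf : IsEnvelopeOn U F f) (hy : y ∈ U) (i : Fin 2) :
    lor (f y) (pd i F y) = 0 := by
  have := lor_pd_eq_neg hf.smooth hF.smooth hF.isOpen hf.incident hy i
  rw [hf.tangent y hy] at this
  linarith

lemma lor_pd_self (hF : IsUnitImmersionOn U F) (hf : IsEnvelopeOn U F f) (hy : y ∈ U)
    (i : Fin 2) : lor (f y) (pd i f y) = 0 := by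
  have := lor_pd_eq_neg hf.smooth hf.smooth hF.isOpen hf.null hy i
  rw [lor_comm (pd i f y)] at this
  linarith

lemma lor_pd_pd (hF : IsUnitImmersionOn U F) (hf : IsEnvelopeOn U F f) (hy : y ∈ U)
    (i j : Fin 2) : lor (f y) (pd i (pd j F) y) = - shapeForm F f y i j := by
  have := lor_pd_eq_neg hf.smooth (contDiffOn_pd hF.smooth hF.isOpen j) hF.isOpen
    (fun z hz => hf.lor_pd hF hz j) hy i
  rw [shapeForm_apply, this, neg_neg]

lemma shapeForm_symm (hF : IsUnitImmersionOn U F) (hf : IsEnvelopeOn U F f) (hy : y ∈ U)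
    (i j : Fin 2) : shapeForm F f y i j = shapeForm F f y j i := by
  rw [← neg_inj, ← hf.lor_pd_pd hF hy, ← hf.lor_pd_pd hF hy, pd_comm hF.smooth hF.isOpen hy]

lemma projDerived_self (hF : IsUnitImmersionOn U F) (hf : IsEnvelopeOn U F f) (hy : y ∈ U) :
    projDerived F y (f y) = 0 :=
  projDerived_eq_zero (hf.incident y hy) fun k => hf.lor_pd hF hy k

lemma contDiffOn_shapeForm (hF : IsUnitImmersionOn U F) (hf : IsEnvelopeOn U F f)
    (i j : Fin 2) : ContDiffOn ℝ ∞ (fun z => shapeForm F f z i j) U :=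
  contDiffOn_lor (contDiffOn_pd hf.smooth hF.isOpen i) (contDiffOn_pd hF.smooth hF.isOpen j)

lemma contDiffOn_det_shapeForm (hF : IsUnitImmersionOn U F) (hf : IsEnvelopeOn U F f) :
    ContDiffOn ℝ ∞ (fun z => (shapeForm F f z).det) U := by
  simp only [Matrix.det_fin_two]
  exact ((hf.contDiffOn_shapeForm hF 0 0).mul (hf.contDiffOn_shapeForm hF 1 1)).sub
    ((hf.contDiffOn_shapeForm hF 0 1).mul (hf.contDiffOn_shapeForm hF 1 0))

lemma lor_projDerived_pd (hF : IsUnitImmersionOn U F) (hf : IsEnvelopeOn U F f)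
    (hh : IsEnvelopeOn U F h) (hy : y ∈ U) (i j : Fin 2) :
    lor (projDerived F y (pd i f y)) (pd j h y)
      = (shapeForm F f y * (metric F y)⁻¹ * shapeForm F h y) i j := by
  simp only [projDerived, hf.tangent y hy, Matrix.mul_apply, Fin.sum_univ_two, lor_add_left,
    lor_smul_left, ← shapeForm_apply, lor_comm (pd _ F y) (pd j h y),
    hh.shapeForm_symm hF hy _ j]
  ring

end IsEnvelopeOn

/-! ### Pairs of envelopes: normal frame, second fundamental form, Ricci equation -/

/-- A smooth immersion into the Lorentz sphere with two distinct envelopes, in coordinates. -/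
structure IsEnvelopePairOn (U : Set Plane) (F f h : Plane → R41) : Prop where
  immersion : IsUnitImmersionOn U F
  left : IsEnvelopeOn U F f
  right : IsEnvelopeOn U F h
  lor_ne : ∀ y ∈ U, lor (f y) (h y) ≠ 0

namespace IsEnvelopePairOn

/-- The Gram matrix is block diagonal, with blocks 1, g and the hyperbolic block of f and h, all
nondegenerate. -/
lemma linearIndependent (H : IsEnvelopePairOn U F f h) (hy : y ∈ U) :
    LinearIndependent ℝ ![F y, pd 0 F y, pd 1 F y, f y, h y] := by
  rw [Fintype.linearIndependent_iff]
  intro c hc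
  simp only [Fin.sum_univ_five, Matrix.cons_val] at hc
  have pair : ∀ z, c 0 * lor (F y) z + c 1 * lor (pd 0 F y) z + c 2 * lor (pd 1 F y) z
      + c 3 * lor (f y) z + c 4 * lor (h y) z = 0 := by
    intro z
    have := congrArg (lor · z) hc
    simpa only [lor_add_left, lor_smul_left, lor_zero_left] using this
  have hne := H.lor_ne y hy
  have hF := H.immersion
  have hsF : ∀ k, lor (F y) (pd k F y) = 0 := fun k => by rw [lor_comm, hF.lor_pd_self hy]
  have hsf : ∀ k, lor (pd k F y) (f y) = 0 := fun k => by rw [lor_comm, H.left.lor_pd hF hy]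
  have hsh : ∀ k, lor (pd k F y) (h y) = 0 := fun k => by rw [lor_comm, H.right.lor_pd hF hy]
  have e0 := pair (F y)
  have e1 := pair (pd 0 F y)
  have e2 := pair (pd 1 F y)
  have e3 := pair (f y)
  have e4 := pair (h y)
  simp only [hF.unit y hy, hF.lor_pd_self hy, H.left.incident y hy, H.right.incident y hy] at e0
  simp only [hsF, H.left.lor_pd hF hy, H.right.lor_pd hF hy, ← metric_apply] at e1 e2
  simp only [lor_comm (F y), hsf, H.left.incident y hy, H.left.null y hy,
    lor_comm (h y) (f y)] at e3
  simp only [lor_comm (F y), hsh, H.right.incident y hy, H.right.null y hy] at e4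
  have hdet := hF.det_ne y hy
  rw [Matrix.det_fin_two] at hdet
  have c3 : c 3 = 0 := (mul_eq_zero.1 (by linarith : c 3 * lor (f y) (h y) = 0)).resolve_right hne
  have c4 : c 4 = 0 := (mul_eq_zero.1 (by linarith : c 4 * lor (f y) (h y) = 0)).resolve_right hne
  have c1 : c 1 = 0 := (mul_eq_zero.1 (by
    linear_combination metric F y 1 1 * e1 - metric F y 1 0 * e2 :
      c 1 * (metric F y 0 0 * metric F y 1 1 - metric F y 0 1 * metric F y 1 0) = 0)).resolve_right
      hdet
  have c2 : c 2 = 0 := (mul_eq_zero.1 (by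
    linear_combination metric F y 0 0 * e2 - metric F y 0 1 * e1 :
      c 2 * (metric F y 0 0 * metric F y 1 1 - metric F y 0 1 * metric F y 1 0) = 0)).resolve_right
      hdet
  intro i
  fin_cases i
  · change c 0 = 0
    linarith
  · exact c1
  · exact c2
  · exact c3
  · exact c4

/-- The envelopes span the normal bundle. -/
lemma projNormal_eq (H : IsEnvelopePairOn U F f h) (hy : y ∈ U) (w : R41) :
    projNormal F y w
      = (lor (f y) (h y))⁻¹ • (lor w (h y) • f y + lor w (f y) • h y) := by
  have hF := H.immersion
  have hne := H.lor_ne y hy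
  rw [← sub_eq_zero]
  set d := projNormal F y w - (lor (f y) (h y))⁻¹ • (lor w (h y) • f y + lor w (f y) • h y)
    with hd
  have hdF : lor d (F y) = 0 := by
    simp [hd, lor_sub_left, lor_smul_left, lor_add_left, hF.lor_projNormal_self hy,
      H.left.incident y hy, H.right.incident y hy]
  have hdk : ∀ k, lor d (pd k F y) = 0 := fun k => by
    simp [hd, lor_sub_left, lor_smul_left, lor_add_left, hF.lor_projNormal_pd hy,
      H.left.lor_pd hF hy, H.right.lor_pd hF hy]
  have hdf : lor d (f y) = 0 := by
    simp only [hd, projNormal, lor_sub_left, lor_projDerived_comm, H.left.projDerived_self hF hy,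
      lor_zero_right, lor_smul_left, lor_add_left, H.left.null y hy, lor_comm (h y) (f y)]
    field_simp
    ring
  have hdh : lor d (h y) = 0 := by
    simp only [hd, projNormal, lor_sub_left, lor_projDerived_comm, H.right.projDerived_self hF hy,
      lor_zero_right, lor_smul_left, lor_add_left, H.right.null y hy]
    field_simp
    ring
  -- The difference is orthogonal to five independent vectors, hence to all of ℝ^{4,1}.
  refine eq_zero_of_lor_eq_zero fun v => ?_
  have hv : v ∈ Submodule.span ℝ (Set.range ![F y, pd 0 F y, pd 1 F y, f y, h y]) := by
    rw [(H.linearIndependent hy).span_eq_top_of_card_eq_finrank' (by simp)]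
    trivial
  induction hv using Submodule.span_induction with
  | mem x hx =>
    obtain ⟨i, rfl⟩ := hx
    fin_cases i
    · exact hdF
    · exact hdk 0
    · exact hdk 1
    · exact hdf
    · exact hdh
  | zero => exact lor_zero_right d
  | add a b _ _ ha hb => rw [lor_add_right, ha, hb, add_zero]
  | smul c a _ ha => rw [lor_smul_right, ha, mul_zero]

lemma projDerived_add_normal (H : IsEnvelopePairOn U F f h) (hy : y ∈ U) (w : R41) :
    w = projDerived F y w
      + (lor (f y) (h y))⁻¹ • (lor w (h y) • f y + lor w (f y) • h y) := by
  rw [← H.projNormal_eq hy, projNormal, add_sub_cancel]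

lemma secondForm_eq (H : IsEnvelopePairOn U F f h) (hy : y ∈ U) (i j : Fin 2) :
    secondForm F i j y = -(lor (f y) (h y))⁻¹ •
      (shapeForm F h y i j • f y + shapeForm F f y i j • h y) := by
  rw [secondForm, H.projNormal_eq hy, lor_comm (pd i (pd j F) y), lor_comm (pd i (pd j F) y),
    H.left.lor_pd_pd H.immersion hy, H.right.lor_pd_pd H.immersion hy]
  module

/-- Since f and h are null, only the cross terms (f, h) survive, and these polarise the determinant.
-/
lemma secondFormDet_eq (H : IsEnvelopePairOn U F f h) (hy : y ∈ U) :
    secondFormDet F y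
      = (lor (f y) (h y))⁻¹ * mixedDet (shapeForm F f y) (shapeForm F h y) := by
  have hne := H.lor_ne y hy
  simp only [secondFormDet, H.secondForm_eq hy, lor_smul_left, lor_smul_right, lor_add_left,
    lor_add_right, H.left.null y hy, H.right.null y hy, lor_comm (h y) (f y), mixedDet,
    H.left.shapeForm_symm H.immersion hy 1 0, H.right.shapeForm_symm H.immersion hy 1 0]
  field_simp
  ring

lemma secondFormDet_eq_zero_iff (H : IsEnvelopePairOn U F f h) (hy : y ∈ U) :
    secondFormDet F y = 0 ↔ mixedDet (shapeForm F f y) (shapeForm F h y) = 0 := by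
  rw [H.secondFormDet_eq hy, mul_eq_zero, or_iff_right (inv_ne_zero (H.lor_ne y hy))]

/-- The Ricci equation: the shape operators of a congruence with flat normal bundle commute. -/
lemma shapeForm_commute (H : IsEnvelopePairOn U F f h) (hflat : IsFlatOn (projNormal F) U)
    (hy : y ∈ U) :
    shapeForm F f y * (metric F y)⁻¹ * shapeForm F h y
      = shapeForm F h y * (metric F y)⁻¹ * shapeForm F f y := by
  have hF := H.immersion
  -- The normal bundle has rank two, so its curvature is seen by the single pairing of R^⊥ f with h.
  have h0 : inducedCurvature (projNormal F) f y = 0 :=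
    hflat f H.left.smooth
      (fun z hz => by rw [projNormal, H.left.projDerived_self hF hz, sub_zero]) y hy
  have h1 := lor_inducedCurvature hF.isOpen (fun _ hτ => hF.contDiffOn_projNormal hτ)
    H.left.smooth H.right.smooth (fun z hz w => by
      rw [projNormal, lor_sub_left, lor_projDerived_comm, H.right.projDerived_self hF hz,
        lor_zero_right, sub_zero]) hy
  simp only [h0, lor_zero_left, projNormal, sub_sub_cancel,
    H.left.lor_projDerived_pd hF H.right hy] at h1
  -- The two products are transposes of each other, so the claim is one equation between
  -- off-diagonal entries.
  have hswap : ∀ i j, (shapeForm F h y * (metric F y)⁻¹ * shapeForm F f y) i j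
      = (shapeForm F f y * (metric F y)⁻¹ * shapeForm F h y) j i := by
    intro i j
    rw [← H.right.lor_projDerived_pd hF H.left hy, ← H.left.lor_projDerived_pd hF H.right hy,
      lor_projDerived_comm, lor_comm]
  ext i j
  rw [hswap]
  fin_cases i <;> fin_cases j
  · rfl
  · simp only [Fin.zero_eta, Fin.mk_one]
    linarith
  · simp only [Fin.zero_eta, Fin.mk_one]
    linarith
  · rfl

/-- As (∂f, f) = 0, the normal part of ∂f is a multiple of f and is orthogonal to every ∂ⱼf; only
the tangential parts contribute. -/
lemma metric_left (H : IsEnvelopePairOn U F f h) (hy : y ∈ U) :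
    metric f y = shapeForm F f y * (metric F y)⁻¹ * shapeForm F f y := by
  have hF := H.immersion
  ext i j
  rw [← H.left.lor_projDerived_pd hF H.left hy, metric_apply]
  conv_lhs => rw [H.projDerived_add_normal hy (pd i f y)]
  simp [lor_add_left, lor_smul_left, H.left.lor_pd_self hF hy, lor_comm (pd i f y) (f y)]

lemma symm (H : IsEnvelopePairOn U F f h) : IsEnvelopePairOn U F h f :=
  ⟨H.immersion, H.right, H.left, fun y hy => by rw [lor_comm]; exact H.lor_ne y hy⟩

lemma metric_right (H : IsEnvelopePairOn U F f h) (hy : y ∈ U) :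
    metric h y = shapeForm F h y * (metric F y)⁻¹ * shapeForm F h y := H.symm.metric_left hy

lemma contDiffOn_mixedDet (H : IsEnvelopePairOn U F f h) :
    ContDiffOn ℝ ∞ (fun z => mixedDet (shapeForm F f z) (shapeForm F h z)) U := by
  have a := H.left.contDiffOn_shapeForm H.immersion
  have b := H.right.contDiffOn_shapeForm H.immersion
  unfold mixedDet
  exact ((((a 0 0).mul (b 1 1)).add ((a 1 1).mul (b 0 0))).sub ((a 0 1).mul (b 1 0))).sub
    ((a 1 0).mul (b 0 1))

lemma posDef_metric_iff (H : IsEnvelopePairOn U F f h) (hy : y ∈ U)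
    (hpos : (metric F y).PosDef) : (metric f y).PosDef ↔ (shapeForm F f y).det ≠ 0 := by
  rw [H.metric_left hy]
  constructor
  · intro hp h0
    have := hp.det_pos
    simp [Matrix.det_mul, h0] at this
  · intro h0
    have hT : (shapeForm F f y).conjTranspose = shapeForm F f y :=
      Matrix.ext fun i j => by simp [H.left.shapeForm_symm H.immersion hy j i]
    have := hpos.inv.conjTranspose_mul_mul_same (B := shapeForm F f y)
      (Matrix.mulVec_injective_of_isUnit ((Matrix.isUnit_iff_isUnit_det _).2 h0.isUnit))
    rwa [hT] at this

/-! ### Inversions and proportional shape forms -/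

/-- If an inversion maps one envelope to the other, their shape forms are proportional. -/
lemma shapeForm_eq_smul (H : IsEnvelopePairOn U F f h) {V : Set Plane} (hV : IsOpen V)
    (hVU : V ⊆ U) {n : R41} (hn : lor n n ≠ 0)
    (hinv : ∀ z ∈ V, ∃ c : ℝ, h z = c • inversion n (f z)) (hy : y ∈ V) :
    ∃ c : ℝ, c ≠ 0 ∧ shapeForm F h y = c • shapeForm F f y := by
  have hF := H.immersion
  -- If c or (f, n) vanished, h would be a multiple of f and hence orthogonal to it.
  have key : ∀ z ∈ V, ∃ c : ℝ, c ≠ 0 ∧ lor (f z) n ≠ 0 ∧ h z = c • inversion n (f z) := by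
    intro z hz
    obtain ⟨c, hc⟩ := hinv z hz
    have hne := H.lor_ne z (hVU hz)
    refine ⟨c, ?_, ?_, hc⟩
    · rintro rfl
      rw [zero_smul] at hc
      exact hne (by rw [hc, lor_zero_right])
    · intro h0
      rw [inversion, h0] at hc
      apply hne
      rw [hc]
      simp [lor_smul_right, H.left.null z (hVU hz)]
  -- Both f and h are orthogonal to ∂F, and n is a combination of them; being constant, it is then
  -- orthogonal to ∂∂F too.
  have hn1 : ∀ k, ∀ z ∈ V, lor n (pd k F z) = 0 := by
    intro k z hz
    obtain ⟨c, hc, hfn, hhz⟩ := key z hz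
    have e := H.right.lor_pd hF (hVU hz) k
    rw [hhz, inversion, lor_smul_left, lor_sub_left, lor_smul_left,
      H.left.lor_pd hF (hVU hz), zero_sub, mul_neg, neg_eq_zero] at e
    have h2 : 2 * lor (f z) n / lor n n ≠ 0 := div_ne_zero (mul_ne_zero two_ne_zero hfn) hn
    exact ((mul_eq_zero.1 ((mul_eq_zero.1 e).resolve_left hc)).resolve_left h2)
  have hn2 : ∀ i k, lor n (pd i (pd k F) y) = 0 := by
    intro i k
    have := lor_pd_eq_neg (contDiffOn_const (c := n))
      ((contDiffOn_pd hF.smooth hF.isOpen k).mono hVU) hV (hn1 k) hy i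
    rw [pd_const, lor_zero_left] at this
    linarith
  obtain ⟨c, hc, -, hhy⟩ := key y hy
  refine ⟨c, hc, Matrix.ext fun i j => ?_⟩
  rw [Matrix.smul_apply, smul_eq_mul, ← neg_inj, ← H.right.lor_pd_pd hF (hVU hy), hhy, inversion,
    lor_smul_left, lor_sub_left, lor_smul_left, hn2, H.left.lor_pd_pd hF (hVU hy)]
  ring

/-- If the shape forms of the envelopes are proportional, nondegenerate, and have nonzero mixed
determinant, then locally an inversion maps one envelope to the other. -/
lemma exists_inversion (H : IsEnvelopePairOn U F f h) {V : Set Plane} (hV : IsOpen V)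
    (hVU : V ⊆ U) (hdet : ∀ z ∈ V, (shapeForm F f z).det ≠ 0)
    (hmix : ∀ z ∈ V, mixedDet (shapeForm F f z) (shapeForm F h z) ≠ 0)
    (hprop : ∀ z ∈ V, shapeForm F h z = (mixedDet (shapeForm F f z) (shapeForm F h z) /
      (2 * (shapeForm F f z).det)) • shapeForm F f z) (hy : y ∈ V) :
    ∃ W ⊆ V, IsOpen W ∧ y ∈ W ∧
      ∃ n : R41, lor n n ≠ 0 ∧ ∀ z ∈ W, ∃ c : ℝ, h z = c • inversion n (f z) := by
  have hF := H.immersion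
  set μ : Plane → ℝ := fun z => mixedDet (shapeForm F f z) (shapeForm F h z) /
      (2 * (shapeForm F f z).det)
  have hμ : ContDiffOn ℝ ∞ μ V := by
    refine (H.contDiffOn_mixedDet.mono hVU).div
      (contDiffOn_const.mul ((H.left.contDiffOn_det_shapeForm hF).mono hVU)) fun z hz => ?_
    exact mul_ne_zero two_ne_zero (hdet z hz)
  have hμ0 : ∀ z ∈ V, μ z ≠ 0 := fun z hz =>
    div_ne_zero (hmix z hz) (mul_ne_zero two_ne_zero (hdet z hz))
  have hprop' : ∀ z ∈ V, ∀ i j, shapeForm F h z i j = μ z * shapeForm F f z i j := by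
    intro z hz i j
    conv_lhs => rw [hprop z hz]
    rfl
  -- The candidate for the inversion vector: its shape form Q - μP vanishes, so ∂N is normal to the
  -- congruence.
  set N : Plane → R41 := fun z => h z - μ z • f z with hN
  have hNs : ContDiffOn ℝ ∞ N V :=
    (H.right.smooth.mono hVU).sub (hμ.smul (H.left.smooth.mono hVU))
  have hFs := hF.smooth.mono hVU
  have hNF : ∀ z ∈ V, lor (N z) (F z) = 0 := fun z hz => by
    simp [hN, lor_sub_left, lor_smul_left, H.left.incident z (hVU hz),
      H.right.incident z (hVU hz)]
  have hNk : ∀ k, ∀ z ∈ V, lor (N z) (pd k F z) = 0 := fun k z hz => by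
    simp [hN, lor_sub_left, lor_smul_left, H.left.lor_pd hF (hVU hz),
      H.right.lor_pd hF (hVU hz)]
  have hdNF : ∀ i, ∀ z ∈ V, lor (pd i N z) (F z) = 0 := fun i z hz => by
    rw [lor_pd_eq_neg hNs hFs hV hNF hz, hNk i z hz, neg_zero]
  have hdNk : ∀ i k, ∀ z ∈ V, lor (pd i N z) (pd k F z) = 0 := fun i k z hz => by
    rw [lor_pd_eq_neg hNs (contDiffOn_pd hFs hV k) hV (hNk k) hz]
    simp only [hN, lor_sub_left, lor_smul_left, H.left.lor_pd_pd hF (hVU hz),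
      H.right.lor_pd_pd hF (hVU hz), hprop' z hz]
    ring
  have hdN : ∀ i, ∀ z ∈ V, pd i N z = (lor (f z) (h z))⁻¹ •
      (lor (pd i N z) (h z) • f z + lor (pd i N z) (f z) • h z) := fun i z hz => by
    conv_lhs => rw [H.projDerived_add_normal (hVU hz) (pd i N z),
      projDerived_eq_zero (hdNF i z hz) (fun k => hdNk i k z hz), zero_add]
  have hddN : ∀ i j k, ∀ z ∈ V, lor (pd j (pd i N) z) (pd k F z) = (lor (f z) (h z))⁻¹ *
      ((lor (pd i N z) (h z) + μ z * lor (pd i N z) (f z)) * shapeForm F f z j k) := by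
    intro i j k z hz
    rw [lor_pd_eq_neg (contDiffOn_pd hNs hV i) (contDiffOn_pd hFs hV k) hV (hdNk i k) hz]
    conv_lhs => rw [hdN i z hz]
    rw [lor_smul_left, lor_add_left, lor_smul_left, lor_smul_left,
      H.left.lor_pd_pd hF (hVU hz), H.right.lor_pd_pd hF (hVU hz), hprop' z hz]
    ring
  -- A Codazzi argument: with τᵢ this expression, symmetry of ∂ⱼ∂ᵢN gives τ₀P₁ₖ = τ₁P₀ₖ, and det P ≠
  -- 0 forces τ = 0. This makes ∂N proportional to N.
  have hτ : ∀ i, ∀ z ∈ V, lor (pd i N z) (h z) + μ z * lor (pd i N z) (f z) = 0 := by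
    intro i z hz
    have hsym : ∀ k, (lor (pd 0 N z) (h z) + μ z * lor (pd 0 N z) (f z)) * shapeForm F f z 1 k
        = (lor (pd 1 N z) (h z) + μ z * lor (pd 1 N z) (f z)) * shapeForm F f z 0 k := by
      intro k
      have := pd_comm hNs hV hz 1 0
      have h2 := congrArg (lor · (pd k F z)) this
      simp only [hddN _ _ _ z hz] at h2
      exact mul_left_cancel₀ (inv_ne_zero (H.lor_ne z (hVU hz))) h2
    have hd := hdet z hz
    have s0 := hsym 0
    have s1 := hsym 1
    refine (mul_eq_zero.1 ?_).resolve_right hd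
    rw [Matrix.det_fin_two]
    fin_cases i
    · change (lor (pd 0 N z) (h z) + μ z * lor (pd 0 N z) (f z)) * _ = 0
      linear_combination shapeForm F f z 0 0 * s1 - shapeForm F f z 0 1 * s0
    · change (lor (pd 1 N z) (h z) + μ z * lor (pd 1 N z) (f z)) * _ = 0
      linear_combination shapeForm F f z 1 0 * s1 - shapeForm F f z 1 1 * s0
  have hθ : ∀ i, ∀ z ∈ V, ∃ θ : ℝ, pd i N z = θ • N z := fun i z hz => by
    refine ⟨(lor (f z) (h z))⁻¹ * lor (pd i N z) (f z), ?_⟩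
    conv_lhs => rw [hdN i z hz, eq_neg_of_add_eq_zero_left (hτ i z hz)]
    simp only [hN]
    module
  have hNN : ∀ z ∈ V, lor (N z) (N z) = -(2 * μ z * lor (f z) (h z)) := fun z hz => by
    simp only [hN, lor_sub_left, lor_sub_right, lor_smul_left, lor_smul_right,
      H.left.null z (hVU hz), H.right.null z (hVU hz), lor_comm (h z) (f z)]
    ring
  have hNN0 : ∀ z ∈ V, lor (N z) (N z) ≠ 0 := fun z hz => by
    rw [hNN z hz]
    exact neg_ne_zero.2 (mul_ne_zero (mul_ne_zero two_ne_zero (hμ0 z hz)) (H.lor_ne z (hVU hz)))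
  -- Pairing with the fixed vector N y gives ∂φ = θφ with the same θ as in ∂N = θN, so N/φ is
  -- locally constant.
  set φ : Plane → ℝ := fun z => lor (N z) (N y)
  have hφs : ContDiffOn ℝ ∞ φ V := contDiffOn_lor hNs contDiffOn_const
  obtain ⟨r, hr, hball⟩ : ∃ r > 0, Metric.ball y r ⊆ V ∩ {z | φ z ≠ 0} := by
    refine Metric.mem_nhds_iff.1 (Filter.inter_mem (hV.mem_nhds hy) ?_)
    exact (hφs.contDiffAt (hV.mem_nhds hy)).continuousAt.eventually_ne (hNN0 y hy)
  have hbV : Metric.ball y r ⊆ V := fun z hz => (hball hz).1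
  have hyr : y ∈ Metric.ball y r := Metric.mem_ball_self hr
  have hconst : ∀ z ∈ Metric.ball y r, (φ z)⁻¹ • N z = (φ y)⁻¹ • N y := by
    have hd : ∀ z ∈ Metric.ball y r, DifferentiableAt ℝ N z ∧ DifferentiableAt ℝ φ z :=
      fun z hz => ⟨differentiableAt_of_contDiffOn hNs hV (hbV hz),
        differentiableAt_of_contDiffOn hφs hV (hbV hz)⟩
    intro z hz
    refine Metric.isOpen_ball.is_const_of_fderiv_eq_zero (𝕜 := ℝ)
      (convex_ball y r).isPreconnected (f := fun z => (φ z)⁻¹ • N z) ?_ ?_ hz hyr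
    · intro x hx
      exact (((hd x hx).2.inv (hball hx).2).smul (hd x hx).1).differentiableWithinAt
    · intro x hx
      have hpd : ∀ i, pd i (fun z => (φ z)⁻¹ • N z) x = 0 := by
        intro i
        obtain ⟨θ, hθx⟩ := hθ i x (hbV hx)
        have hφx : φ x ≠ 0 := (hball hx).2
        have h1 : pd i φ x = θ * φ x := by
          have := pd_lor (hd x hx).1 (differentiableAt_const (N y)) i
          rw [pd_const, lor_zero_right, add_zero, hθx, lor_smul_left] at this
          exact this
        have h2 : pd i (fun z => (φ z)⁻¹) x = -(θ * φ x) / φ x ^ 2 := by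
          rw [← h1]
          have h3 := ((hasDerivAt_inv hφx).comp_hasFDerivAt x (hd x hx).2.hasFDerivAt).fderiv
          change fderiv ℝ (Inv.inv ∘ φ) x _ = _
          rw [h3]
          simp only [pd, smul_apply, smul_eq_mul]
          ring
        rw [pd_smul ((hd x hx).2.fun_inv hφx) (hd x hx).1, h2, hθx, smul_smul, ← add_smul]
        rw [show -(θ * φ x) / φ x ^ 2 + (φ x)⁻¹ * θ = 0 by field_simp; ring, zero_smul]
      ext1 w
      rw [fderiv_eq_sum_pd]
      simp [hpd]
  refine ⟨Metric.ball y r, hbV, Metric.isOpen_ball, hyr, N y, hNN0 y hy, fun z hz =>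
    ⟨μ z, ?_⟩⟩
  have hz' := hbV hz
  have hφz : φ z ≠ 0 := (hball hz).2
  have hφy : φ y ≠ 0 := (hball hyr).2
  have hε := H.lor_ne z (hVU hz')
  have hμz := hμ0 z hz'
  obtain ⟨a, ha, hNy⟩ : ∃ a : ℝ, a ≠ 0 ∧ N y = a • N z := by
    refine ⟨φ y * (φ z)⁻¹, mul_ne_zero hφy (inv_ne_zero hφz), ?_⟩
    rw [mul_smul, hconst z hz, smul_smul, mul_inv_cancel₀ hφy, one_smul]
  have hfN : lor (f z) (N z) = lor (f z) (h z) := by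
    simp [hN, lor_sub_right, lor_smul_right, H.left.null z (hVU hz')]
  -- From (f, N) = (f, h) and (N, N) = -2μ(f, h), the inversion in N sends f to f + μ⁻¹N = μ⁻¹h.
  have hcoef : 2 * lor (f z) (N y) / lor (N y) (N y) * a = - (μ z)⁻¹ := by
    rw [hNy, lor_smul_left, lor_smul_right, lor_smul_right, hNN z hz', hfN]
    field_simp
  have hlast : (2 * lor (f z) (N y) / lor (N y) (N y)) • N y = - (μ z)⁻¹ • N z := by
    rw [← hcoef, mul_smul, ← hNy]
  rw [inversion, hlast]
  simp only [hN]
  rw [smul_sub, smul_smul, mul_neg, mul_inv_cancel₀ hμz]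
  module

end IsEnvelopePairOn

end Envelope

/-! ### Charts -/

/-- The form `(dF, dF)` in terms of its matrix. -/
lemma lor_fderiv_self (F : Plane → R41) (y w : Plane) :
    lor (fderiv ℝ F y w) (fderiv ℝ F y w) = w.ofLp ⬝ᵥ (metric F y).mulVec w.ofLp := by
  simp only [fderiv_eq_sum_pd, Fin.sum_univ_two, lor_add_left, lor_add_right, lor_smul_left,
    lor_smul_right, dotProduct, Matrix.mulVec, metric_apply]
  ring

lemma posDef_metric_iff_forall (F : Plane → R41) (y : Plane) :
    (metric F y).PosDef ↔ ∀ w : Plane, w ≠ 0 → 0 < lor (fderiv ℝ F y w) (fderiv ℝ F y w) := by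
  constructor
  · intro h w hw
    rw [lor_fderiv_self]
    exact h.dotProduct_mulVec_pos (x := w.ofLp) (by simpa using hw)
  · intro h
    refine Matrix.PosDef.of_dotProduct_mulVec_pos
      (Matrix.ext fun i j => by simp [metric_symm F y j i]) fun x hx => ?_
    have := h (WithLp.toLp 2 x) (by simpa using hx)
    rwa [lor_fderiv_self] at this

lemma metric_eq_smul_iff (f h : Plane → R41) (y : Plane) (c : ℝ) :
    metric h y = c • metric f y ↔ ∀ w : Plane,
      lor (fderiv ℝ h y w) (fderiv ℝ h y w) = c * lor (fderiv ℝ f y w) (fderiv ℝ f y w) := by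
  constructor
  · intro hm w
    rw [lor_fderiv_self, lor_fderiv_self, hm, Matrix.smul_mulVec, dotProduct_smul, smul_eq_mul]
  · intro hw
    have key : ∀ a b : ℝ, a * (a * metric h y 0 0 + b * metric h y 0 1)
        + b * (a * metric h y 0 1 + b * metric h y 1 1)
        = c * (a * (a * metric f y 0 0 + b * metric f y 0 1)
        + b * (a * metric f y 0 1 + b * metric f y 1 1)) := by
      intro a b
      have := hw (WithLp.toLp 2 ![a, b])
      simp only [lor_fderiv_self, dotProduct, Matrix.mulVec, Fin.sum_univ_two, Matrix.cons_val_zero,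
        Matrix.cons_val_one, metric_symm _ y 1 0] at this
      linarith
    -- Polarisation: these three vectors determine a quadratic form in two variables.
    have h0 := key 1 0
    have h1 := key 0 1
    have h2 := key 1 1
    ext i j
    rw [Matrix.smul_apply, smul_eq_mul]
    fin_cases i <;> fin_cases j <;>
      simp only [Fin.zero_eta, Fin.mk_one, metric_symm _ y 1 0] <;> linarith

section Surface

variable {M : Type*} [TopologicalSpace M] [ChartedSpace Plane M] [IsManifold (𝓡 2) ∞ M]
  {e : OpenPartialHomeomorph M Plane} {y : Plane} {s f h : M → R41}

lemma contDiffOn_comp_chart_symm (hf : ContMDiff (𝓡 2) 𝓘(ℝ, R41) ∞ f) (he : e ∈ atlas Plane M) :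
    ContDiffOn ℝ ∞ (f ∘ e.symm) e.target :=
  contMDiffOn_iff_contDiffOn.1 (hf.comp_contMDiffOn
    (contMDiffOn_symm_of_mem_maximalAtlas (IsManifold.subset_maximalAtlas he)))

/-- The differential of a chart identifies the tangent space with the coordinate plane. -/
lemma exists_tangent_equiv (he : e ∈ atlas Plane M) (hy : y ∈ e.target) :
    ∃ L : Plane ≃L[ℝ] TangentSpace (𝓡 2) (e.symm y), ∀ f : M → R41,
      ContMDiff (𝓡 2) 𝓘(ℝ, R41) ∞ f →
        ∀ w, diff f (e.symm y) (L w) = fderiv ℝ (f ∘ e.symm) y w := by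
  have : IsManifold (𝓡 2) 1 M := IsManifold.of_le (n := ∞) (by simp)
  have hd := mdifferentiable_of_mem_atlas (I := 𝓡 2) he
  refine ⟨hd.symm.mfderiv hy, fun f hf w => ?_⟩
  have hfd : MDifferentiableAt (𝓡 2) 𝓘(ℝ, R41) f (e.symm y) :=
    (hf.mdifferentiable (by simp)) _
  rw [← mfderiv_eq_fderiv, mfderiv_comp y hfd (hd.mdifferentiableAt_symm hy)]
  rfl

lemma isRegularAt_iff (hf : ContMDiff (𝓡 2) 𝓘(ℝ, R41) ∞ f) (he : e ∈ atlas Plane M)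
    (hy : y ∈ e.target) :
    IsRegularAt f (e.symm y) ↔ (metric (f ∘ e.symm) y).PosDef := by
  obtain ⟨L, hL⟩ := exists_tangent_equiv he hy
  rw [posDef_metric_iff_forall]
  constructor
  · intro hr w hw
    rw [← hL f hf]
    exact hr (L w) (by simpa using hw)
  · intro hr v hv
    have := hr (L.symm v) (by simpa using hv)
    rwa [← hL f hf, L.apply_symm_apply] at this

lemma inducedForm_eq_mul_iff (hf : ContMDiff (𝓡 2) 𝓘(ℝ, R41) ∞ f)
    (hh : ContMDiff (𝓡 2) 𝓘(ℝ, R41) ∞ h) (he : e ∈ atlas Plane M) (hy : y ∈ e.target) (c : ℝ) :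
    (∀ v, inducedForm h (e.symm y) v = c * inducedForm f (e.symm y) v)
      ↔ metric (h ∘ e.symm) y = c • metric (f ∘ e.symm) y := by
  obtain ⟨L, hL⟩ := exists_tangent_equiv he hy
  rw [metric_eq_smul_iff]
  constructor
  · intro hr w
    rw [← hL f hf, ← hL h hh]
    exact hr (L w)
  · intro hr v
    have := hr (L.symm v)
    rwa [← hL f hf, ← hL h hh, L.apply_symm_apply] at this

lemma IsSphereCongruence.posDef_metric (hs : IsSphereCongruence s) (he : e ∈ atlas Plane M)
    (hy : y ∈ e.target) : (metric (s ∘ e.symm) y).PosDef :=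
  (isRegularAt_iff hs.smooth he hy).1 (hs.regular _)

lemma IsSphereCongruence.isUnitImmersionOn (hs : IsSphereCongruence s)
    (he : e ∈ atlas Plane M) : IsUnitImmersionOn e.target (s ∘ e.symm) where
  isOpen := e.open_target
  smooth := contDiffOn_comp_chart_symm hs.smooth he
  unit y _ := hs.unit (e.symm y)
  det_ne _ hy := (hs.posDef_metric he hy).det_pos.ne'

lemma IsEnvelope.isEnvelopeOn (hf : IsEnvelope s f) (he : e ∈ atlas Plane M) :
    IsEnvelopeOn e.target (s ∘ e.symm) (f ∘ e.symm) where
  smooth := contDiffOn_comp_chart_symm hf.smooth he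
  null y _ := hf.null (e.symm y)
  incident y _ := hf.incident (e.symm y)
  tangent y hy i := by
    obtain ⟨L, hL⟩ := exists_tangent_equiv he hy
    rw [pd, ← hL f hf.smooth]
    exact hf.tangent _ _

lemma IsSphereCongruence.isEnvelopePairOn (hs : IsSphereCongruence s) (hf : IsEnvelope s f)
    (hh : IsEnvelope s h) (hfh : ∀ x, LinearIndependent ℝ ![f x, h x])
    (he : e ∈ atlas Plane M) :
    IsEnvelopePairOn e.target (s ∘ e.symm) (f ∘ e.symm) (h ∘ e.symm) where
  immersion := hs.isUnitImmersionOn he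
  left := hf.isEnvelopeOn he
  right := hh.isEnvelopeOn he
  lor_ne y _ := lor_ne_zero_of_linearIndependent (hf.null _) (hh.null _) (hfh (e.symm y))

/-! ### Flatness on the surface and the Darboux condition -/

lemma IsSphereCongruence.derivedBundleFlat_iff (hs : IsSphereCongruence s) :
    DerivedBundleFlat s ↔ HasConstantCurvature s 1 :=
  forall₂_congr fun _ he =>
    (hs.isUnitImmersionOn he).isFlatOn_projDerived_iff.trans
      (forall₂_congr fun _ hy => ((hs.isUnitImmersionOn he).gaussCurvature_eq_one_iff hy).symm)

/-- The derived bundle is flat if and only if the shape forms of the two envelopes are apolar. -/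
lemma IsSphereCongruence.derivedBundleFlat_iff_mixedDet (hs : IsSphereCongruence s)
    (hf : IsEnvelope s f) (hh : IsEnvelope s h)
    (hfh : ∀ x, LinearIndependent ℝ ![f x, h x]) :
    DerivedBundleFlat s ↔ ∀ e ∈ atlas Plane M, ∀ y ∈ e.target,
      mixedDet (shapeForm (s ∘ e.symm) (f ∘ e.symm) y) (shapeForm (s ∘ e.symm) (h ∘ e.symm) y)
        = 0 :=
  forall₂_congr fun _ he =>
    (hs.isUnitImmersionOn he).isFlatOn_projDerived_iff.trans
      (forall₂_congr fun _ hy =>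
        (hs.isEnvelopePairOn hf hh hfh he).secondFormDet_eq_zero_iff hy)

lemma IsSphereCongruence.isRegularAt_left_iff (hs : IsSphereCongruence s) (hf : IsEnvelope s f)
    (hh : IsEnvelope s h) (hfh : ∀ x, LinearIndependent ℝ ![f x, h x])
    (he : e ∈ atlas Plane M) (hy : y ∈ e.target) :
    IsRegularAt f (e.symm y) ↔ (shapeForm (s ∘ e.symm) (f ∘ e.symm) y).det ≠ 0 :=
  (isRegularAt_iff hf.smooth he hy).trans
    ((hs.isEnvelopePairOn hf hh hfh he).posDef_metric_iff hy (hs.posDef_metric he hy))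

lemma IsSphereCongruence.isRegularAt_right_iff (hs : IsSphereCongruence s)
    (hf : IsEnvelope s f) (hh : IsEnvelope s h)
    (hfh : ∀ x, LinearIndependent ℝ ![f x, h x])
    (he : e ∈ atlas Plane M) (hy : y ∈ e.target) :
    IsRegularAt h (e.symm y) ↔ (shapeForm (s ∘ e.symm) (h ∘ e.symm) y).det ≠ 0 :=
  (isRegularAt_iff hh.smooth he hy).trans
    ((hs.isEnvelopePairOn hf hh hfh he).symm.posDef_metric_iff hy (hs.posDef_metric he hy))

/-- Were the mixed determinant nonzero somewhere, it would be so on an open set. Near a regular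
point there, conformality makes the shape forms proportional, and an inversion excluded by
nontriviality appears. -/
lemma AreDarbouxTransforms.derivedBundleFlat (hD : AreDarbouxTransforms f h)
    (hs : IsRibaucour s) (hf : IsEnvelope s f) (hh : IsEnvelope s h)
    (hreg : Dense {x : M | IsRegularAt f x ∧ IsRegularAt h x}) : DerivedBundleFlat s := by
  have hs' := hs.toIsSphereCongruence
  have hfh := hD.distinct
  rw [hs'.derivedBundleFlat_iff_mixedDet hf hh hfh]
  intro e he y hy
  by_contra hm
  have H := hs'.isEnvelopePairOn hf hh hfh he
  set P := shapeForm (s ∘ e.symm) (f ∘ e.symm)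
  set Q := shapeForm (s ∘ e.symm) (h ∘ e.symm)
  have hne : ∀ {u : Plane → ℝ}, ContDiffOn ℝ ∞ u e.target →
      IsOpen (e.target ∩ {z | u z ≠ 0}) := fun hu =>
    hu.continuousOn.isOpen_inter_preimage e.open_target isOpen_ne
  have hV₀ := hne H.contDiffOn_mixedDet
  obtain ⟨x, ⟨z, hz, rfl⟩, hzf, hzh⟩ := hreg.inter_open_nonempty _
    (e.symm.isOpen_image_of_subset_source hV₀ Set.inter_subset_left) ⟨_, y, ⟨hy, hm⟩, rfl⟩
  -- Both shape forms are kept invertible on V, since conformality is only available where both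
  -- envelopes are immersed.
  set V := (e.target ∩ {z | mixedDet (P z) (Q z) ≠ 0}) ∩ (e.target ∩ {z | (P z).det ≠ 0})
    ∩ (e.target ∩ {z | (Q z).det ≠ 0})
  have hV : IsOpen V := (hV₀.inter (hne (H.left.contDiffOn_det_shapeForm H.immersion))).inter
    (hne (H.right.contDiffOn_det_shapeForm H.immersion))
  have hVe : V ⊆ e.target := fun z hz => hz.2.1
  have hzV : z ∈ V :=
    ⟨⟨hz, hz.1, (hs'.isRegularAt_left_iff hf hh hfh he hz.1).1 hzf⟩,
      hz.1, (hs'.isRegularAt_right_iff hf hh hfh he hz.1).1 hzh⟩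
  obtain ⟨W, hWV, hW, hzW, n, hn, hinv⟩ := H.exists_inversion hV hVe (fun z hz => hz.1.2.2)
    (fun z hz => hz.1.1.2) (fun z hz => by
      have hze := hVe hz
      obtain ⟨c, -, hc⟩ := hD.conformal (e.symm z)
        ((hs'.isRegularAt_left_iff hf hh hfh he hze).2 hz.1.2.2)
        ((hs'.isRegularAt_right_iff hf hh hfh he hze).2 hz.2.2)
      rw [inducedForm_eq_mul_iff hf.smooth hh.smooth he hze, H.metric_left hze,
        H.metric_right hze] at hc
      exact eq_smul_of_mixedDet_ne_zero hz.1.2.2 (hs'.posDef_metric he hze).inv.det_pos.ne'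
        (H.shapeForm_commute (hs.normal_flat e he) hze) hc hz.1.1.2) hzV
  refine hD.nontrivial (e.symm '' W)
    (e.symm.isOpen_image_of_subset_source hW (hWV.trans hVe)) ⟨_, z, hzW, rfl⟩ ⟨n, hn, ?_⟩
  rintro _ ⟨w, hw, rfl⟩
  exact hinv w hw

lemma areDarbouxTransforms_of_derivedBundleFlat (hs : IsRibaucour s) (hf : IsEnvelope s f)
    (hh : IsEnvelope s h) (hfh : ∀ x, LinearIndependent ℝ ![f x, h x])
    (hreg : Dense {x : M | IsRegularAt f x ∧ IsRegularAt h x}) (hflat : DerivedBundleFlat s) :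
    AreDarbouxTransforms f h := by
  have hs' := hs.toIsSphereCongruence
  rw [hs'.derivedBundleFlat_iff_mixedDet hf hh hfh] at hflat
  refine ⟨hfh, ⟨s, hs, hf, hh⟩, fun x hxf hxh => ?_, ?_⟩
  · set e := chartAt Plane x
    have he : e ∈ atlas Plane M := chart_mem_atlas Plane x
    have hy : e x ∈ e.target := mem_chart_target Plane x
    have hx : e.symm (e x) = x := e.left_inv (mem_chart_source Plane x)
    have H := hs'.isEnvelopePairOn hf hh hfh he
    rw [← hx] at hxf hxh ⊢
    obtain ⟨c, hc⟩ := exists_smul_of_mixedDet_eq_zero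
      ((hs'.isRegularAt_left_iff hf hh hfh he hy).1 hxf)
      (H.shapeForm_commute (hs.normal_flat e he) hy) (hflat e he _ hy)
    rw [← H.metric_left hy, ← H.metric_right hy] at hc
    refine ⟨c, ?_, (inducedForm_eq_mul_iff hf.smooth hh.smooth he hy c).2 hc⟩
    -- The algebra does not give the sign of c; a diagonal entry of the two positive definite
    -- metrics does.
    have h1 := ((isRegularAt_iff hf.smooth he hy).1 hxf).diag_pos (i := 0)
    have h2 := ((isRegularAt_iff hh.smooth he hy).1 hxh).diag_pos (i := 0)
    rw [hc, Matrix.smul_apply, smul_eq_mul] at h2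
    exact (pos_iff_pos_of_mul_pos h2).2 h1
  · rintro U hU hUne ⟨n, hn, hinv⟩
    -- At a regular point of U an inversion would give Q = cP and mixed determinant 2c det P ≠ 0,
    -- against flatness.
    obtain ⟨x, hxU, hxf, hxh⟩ := hreg.inter_open_nonempty U hU hUne
    set e := chartAt Plane x
    have he : e ∈ atlas Plane M := chart_mem_atlas Plane x
    have hy : e x ∈ e.target := mem_chart_target Plane x
    have hx : e.symm (e x) = x := e.left_inv (mem_chart_source Plane x)
    have H := hs'.isEnvelopePairOn hf hh hfh he
    obtain ⟨c, hc, hQ⟩ := H.shapeForm_eq_smul (V := e.target ∩ e.symm ⁻¹' U)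
      (e.symm.isOpen_inter_preimage hU) Set.inter_subset_left hn (fun z hz => hinv _ hz.2)
      (y := e x) ⟨hy, by rwa [Set.mem_preimage, hx]⟩
    rw [← hx, hs'.isRegularAt_left_iff hf hh hfh he hy] at hxf
    have hm := hflat e he _ hy
    rw [hQ, mixedDet_smul_self] at hm
    exact mul_ne_zero (mul_ne_zero two_ne_zero hc) hxf hm

end Surface

end SphereGeometry

end

open SphereGeometry
theorem mainTheorem5 {M : Type*} [TopologicalSpace M] [ChartedSpace Plane M]
    [IsManifold (𝓡 2) ∞ M] (s f h : M → R41)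
    (hs : IsRibaucour s) (hf : IsEnvelope s f) (hh : IsEnvelope s h)
    (hfh : ∀ x, LinearIndependent ℝ ![f x, h x])
    (hreg : Dense {x : M | IsRegularAt f x ∧ IsRegularAt h x}) :
    (AreDarbouxTransforms f h ↔ DerivedBundleFlat s) ∧
      (DerivedBundleFlat s ↔ HasConstantCurvature s 1) :=
  ⟨⟨fun hD => hD.derivedBundleFlat hs hf hh hreg,
    areDarbouxTransforms_of_derivedBundleFlat hs hf hh hfh hreg⟩,
    hs.toIsSphereCongruence.derivedBundleFlat_iff⟩
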